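/- **Setting.** A layer on $n$ qubits is a tensor product of two-qubit unitaries acting on pairwise disjoint pairs of qubits (and the identity on the remaining qubits); a circuit of depth $d$ is a product $U_d\cdots U_1$ of $d$ layers, and the circuit complexity of $|\psi\rangle$ is the least depth of a circuit $C$ with $|\psi\rangle=C|0\rangle^{\otimes n}$ ($\infty$ if there is none). Consider one of three settings for the gates, and for $D\ge 0$ define $k$ accordingly: (a) gates may act on any two qubits, and $k=2^D$; (b) the qubits $0,\dots,n-1$ form a chain, gates act on two neighbouring qubits, and $k=2D$; (c) the qubits sit at $n$ distinct sites of the square lattice $\mathbb Z^2$, gates act on two nearest neighbours, and $k=\gamma_2(D)$, the largest cardinality of a set obtained from $\{(0,0)\}\subset\mathbb Z^2$ in $D$ steps, where in each step every point of the current set may add at most one of its lattice neighbours. Write $\psi=|\psi\rangle\langle\psi|$, let $\rho_s$ denote the reduced density matrix of $\rho$ on the qubits in $s$, and let $\|\cdot\|_1$ be the trace norm. Put $k'=\min(k,n)$. **Theorem.** There is a universal constant $c>0$ such that the following holds for all $n\ge 1$, each of the three settings, all $D\geq 0$ with $k\ge 1$ (that is, $D\ge 1$ in setting (b)), and all $\varepsilon>0$.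 There are a number of samples $$N\le c\,\frac{n^2\,10^{k}\,\log\binom nk}{\varepsilon^4}\quad\text{if } k<n,\qquad N\le c\,\frac{n^2\,10^{n}}{\varepsilon^4}\quad\text{if } k\ge n,$$ and a test that uses $N$ copies of an unknown $n$-qubit (possibly mixed) state $\rho$ and distinguishes, with probability at least $2/3$, between the two cases 1. $\|\psi-\rho\|_1<\frac{\varepsilon^2}{12n}$ for some $|\psi\rangle$ of circuit complexity at most $D$; 2. $\|\psi-\rho\|_1>\varepsilon$ for every $|\psi\rangle$ of circuit complexity at most $D$. More precisely, the test measures each qubit of each copy in one of the bases $\sigma_X,\sigma_Y,\sigma_Z$, chosen uniformly and independently; from the records it computes, by a rule that does not depend on $\rho$, a matrix $\tilde\rho_s$ for every set $s$ of $k'$ qubits, such that for every $\rho$, with probability at least $2/3$, $\|\tilde\rho_s-\rho_s\|_1\le\frac{\varepsilon^2}{12n}$ for all these $s$ simultaneously; and it answers "Yes" if and only if there is some $|\psi\rangle$ of circuit complexity at most $D$ with $\|\psi_s-\tilde\rho_s\|_1<\frac{\varepsilon^2}{6n}$ for all $s$ with $|s|=k'$. In case 1 it answers "Yes" with probability at least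 $2/3$; in case 2 it answers "No" with probability at least $2/3$. -/

import Mathlib

namespace ShallowTest

open Matrix
open scoped ComplexOrder

/-! ### States of `n` qubits -/

/-- Computational basis labels of a register of qubits indexed by `ι`. -/
abbrev Bits (ι : Type) : Type := ι → Fin 2

/-- Density matrices: positive semidefinite of trace one. -/
def IsState {ι : Type} [Fintype ι] (ρ : Matrix ι ι ℂ) : Prop :=
  ρ.PosSemidef ∧ ρ.trace = 1

/-- The trace norm `‖A‖₁ = Tr √(Aᴴ A)`, i.e. the sum of the singular values of `A`. -/
noncomputable def traceNorm {ι : Type} [Fintype ι] [DecidableEq ι] (A : Matrix ι ι ℂ) : ℝ :=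
  ∑ i, Real.sqrt ((Matrix.isHermitian_conjTranspose_mul_self A).eigenvalues i)

/-- The rank-one operator `|ψ⟩⟨ψ|`. -/
def pureState {ι : Type} (ψ : ι → ℂ) : Matrix ι ι ℂ := Matrix.vecMulVec ψ (star ψ)

/-- The label that agrees with `a` on the qubits in `s` and with `z` on the other qubits. -/
def glue {n : ℕ} (s : Finset (Fin n)) (a : Bits {i // i ∈ s}) (z : Bits {i // i ∉ s}) :
    Bits (Fin n) :=
  fun i => if h : i ∈ s then a ⟨i, h⟩ else z ⟨i, h⟩

/-- The reduced density matrix on the qubits in `s`: trace out the complement of `s`. -/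
def reduced {n : ℕ} (ρ : Matrix (Bits (Fin n)) (Bits (Fin n)) ℂ) (s : Finset (Fin n)) :
    Matrix (Bits {i // i ∈ s}) (Bits {i // i ∈ s}) ℂ :=
  fun a b => ∑ z : Bits {i // i ∉ s}, ρ (glue s a z) (glue s b z)

/-! ### Circuits of two-qubit gates -/

/-- A two-qubit unitary on a pair of qubits joined by an edge of `G`. -/
structure Gate {n : ℕ} (G : SimpleGraph (Fin n)) where
  fst : Fin n
  snd : Fin n
  adj : G.Adj fst snd
  V : Matrix (Fin 2 × Fin 2) (Fin 2 × Fin 2) ℂ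
  unitary : V ∈ Matrix.unitaryGroup (Fin 2 × Fin 2) ℂ

/-- The two qubits a gate acts on. -/
def Gate.support {n : ℕ} {G : SimpleGraph (Fin n)} (g : Gate G) : Finset (Fin n) :=
  {g.fst, g.snd}

/-- The gate as an operator on the whole register, the identity on all other qubits. -/
noncomputable def Gate.toMatrix {n : ℕ} {G : SimpleGraph (Fin n)} (g : Gate G) :
    Matrix (Bits (Fin n)) (Bits (Fin n)) ℂ :=
  fun x y =>
    if ∀ l, l ∉ g.support → x l = y l then g.V (x g.fst, x g.snd) (y g.fst, y g.snd) else 0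

/-- A layer: finitely many gates that act on pairwise disjoint pairs of qubits. -/
structure Layer {n : ℕ} (G : SimpleGraph (Fin n)) where
  gates : List (Gate G)
  disjoint : gates.Pairwise fun g h => Disjoint g.support h.support

/-- The operator of a layer. Its gates act on disjoint qubits, so this product is their
tensor product (with the identity on untouched qubits). -/
noncomputable def Layer.toMatrix {n : ℕ} {G : SimpleGraph (Fin n)} (L : Layer G) :
    Matrix (Bits (Fin n)) (Bits (Fin n)) ℂ :=
  (L.gates.map Gate.toMatrix).prod

/-- A circuit is its sequence of layers, the layer applied first standing first;
its depth is the length of the sequence. -/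
abbrev Circuit {n : ℕ} (G : SimpleGraph (Fin n)) : Type := List (Layer G)

/-- The vector `|0⟩ ⊗ ⋯ ⊗ |0⟩`. -/
def ketZero (n : ℕ) : Bits (Fin n) → ℂ := Pi.single (fun _ => 0) 1

/-- `U_D ⋯ U_1 |0⟩ ⊗ ⋯ ⊗ |0⟩`. -/
noncomputable def Circuit.output {n : ℕ} {G : SimpleGraph (Fin n)} (C : Circuit G) :
    Bits (Fin n) → ℂ :=
  List.foldl (fun v L => L.toMatrix *ᵥ v) (ketZero n) C

/-- The least depth of a circuit with output `ψ` (`⊤` if there is none). -/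
noncomputable def circuitComplexity {n : ℕ} (G : SimpleGraph (Fin n)) (ψ : Bits (Fin n) → ℂ) :
    ℕ∞ :=
  ⨅ (C : Circuit G) (_ : C.output = ψ), (C.length : ℕ∞)

/-! ### Geometries and their localities -/

/-- Nearest-neighbour adjacency on the square lattice `ℤ × ℤ`. -/
def squareLattice : SimpleGraph (ℤ × ℤ) where
  Adj p q := |p.1 - q.1| + |p.2 - q.2| = 1
  symm := ⟨fun p q h => by rw [abs_sub_comm q.1, abs_sub_comm q.2]; exact h⟩
  loopless := ⟨fun p h => by simp at h⟩

/-- `T` arises from `S` by adding, for every `p ∈ S`, at most one neighbour of `p`. -/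
def GrowStep (S T : Finset (ℤ × ℤ)) : Prop :=
  ∃ f : ℤ × ℤ → ℤ × ℤ, (∀ p ∈ S, f p = p ∨ squareLattice.Adj p (f p)) ∧ T = S ∪ S.image f

/-- `S` arises from `{(0, 0)}` in `D` growth steps. -/
def Reachable : ℕ → Finset (ℤ × ℤ) → Prop
  | 0, S => S = {(0, 0)}
  | D + 1, S => ∃ R, Reachable D R ∧ GrowStep R S

/-- `γ₂(D)`: the largest cardinality of a set reachable in `D` growth steps. -/
noncomputable def gammaTwo (D : ℕ) : ℕ :=
  sSup {m : ℕ | ∃ S, Reachable D S ∧ S.card = m}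

theorem card_le_of_reachable : ∀ (D : ℕ) (S : Finset (ℤ × ℤ)), Reachable D S → S.card ≤ 2 ^ D
  | 0, S, h => by
      have h' : S = {(0, 0)} := h
      simp [h']
  | D + 1, S, ⟨R, hR, f, _, hS⟩ => by
      have h1 := card_le_of_reachable D R hR
      have h2 : S.card ≤ R.card + (R.image f).card := by
        rw [hS]; exact Finset.card_union_le _ _
      have h3 : (R.image f).card ≤ R.card := Finset.card_image_le
      rw [pow_succ]; omega

/-- The supremum that defines `gammaTwo` is over a bounded set. -/
theorem card_le_gammaTwo {D : ℕ} {S : Finset (ℤ × ℤ)} (h : Reachable D S) :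
    S.card ≤ gammaTwo D :=
  le_csSup ⟨2 ^ D, by rintro m ⟨T, hT, rfl⟩; exact card_le_of_reachable D T hT⟩ ⟨S, h, rfl⟩

/-- The three settings for the gates: between arbitrary qubits; between neighbours on the chain
`0, 1, …, n - 1`; between neighbours on the square lattice, the qubits being located at `n`
distinct lattice sites. -/
inductive Geometry (n : ℕ) : Type
  | general : Geometry n
  | chain : Geometry n
  | square (site : Fin n ↪ ℤ × ℤ) : Geometry n

/-- The pairs of qubits on which gates are allowed. -/
def Geometry.graph {n : ℕ} : Geometry n → SimpleGraph (Fin n)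
  | .general => ⊤
  | .chain => SimpleGraph.pathGraph n
  | .square site => squareLattice.comap site

/-- The locality parameter `k`. -/
noncomputable def Geometry.locality {n : ℕ} : Geometry n → ℕ → ℕ
  | .general, D => 2 ^ D
  | .chain, D => 2 * D
  | .square _, D => gammaTwo D

/-! ### Random Pauli measurements -/

/-- The Pauli matrices `σ_X, σ_Y, σ_Z`. -/
def pauli : Fin 3 → Matrix (Fin 2) (Fin 2) ℂ :=
  ![!![0, 1; 1, 0], !![0, -Complex.I; Complex.I, 0], !![1, 0; 0, -1]]

/-- The record of one measured copy: for each qubit the Pauli basis and the outcome bit. -/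
abbrev Record (n : ℕ) : Type := Fin n → Fin 3 × Fin 2

/-- The POVM element of a record when each qubit is measured in one of the three Pauli bases,
chosen uniformly and independently: `⨂ᵢ (1/3) · (I + (-1)^{bᵢ} σ_{Pᵢ}) / 2`. -/
noncomputable def recordEffect {n : ℕ} (r : Record n) :
    Matrix (Bits (Fin n)) (Bits (Fin n)) ℂ :=
  fun x y => ∏ i, ((1 / 6 : ℂ) • (1 + (-1 : ℂ) ^ ((r i).2 : ℕ) • pauli (r i).1)) (x i) (y i)

/-- The probability of the record `r` when one copy of `ρ` is measured. -/
noncomputable def recordProb {n : ℕ} (ρ : Matrix (Bits (Fin n)) (Bits (Fin n)) ℂ)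
    (r : Record n) : ℝ :=
  ((ρ * recordEffect r).trace).re

open Classical in
/-- The probability of an event about the records when `N` copies of `ρ` are measured
independently. -/
noncomputable def dataProb {n N : ℕ} (ρ : Matrix (Bits (Fin n)) (Bits (Fin n)) ℂ)
    (E : (Fin N → Record n) → Prop) : ℝ :=
  ∑ d : Fin N → Record n, if E d then ∏ j, recordProb ρ (d j) else 0

/-! ### The test -/

/-- A family of candidate marginals, one for each set of qubits. -/
abbrev Marginals (n : ℕ) : Type :=
  (s : Finset (Fin n)) → Matrix (Bits {i // i ∈ s}) (Bits {i // i ∈ s}) ℂ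

/-- All marginals of `ρ` on exactly `k` qubits are given by `τ` up to trace norm `η`. -/
def MarginalsWithin {n : ℕ} (k : ℕ) (η : ℝ) (τ : Marginals n)
    (ρ : Matrix (Bits (Fin n)) (Bits (Fin n)) ℂ) : Prop :=
  ∀ s : Finset (Fin n), s.card = k → traceNorm (τ s - reduced ρ s) ≤ η

/-- The outcome "Yes" of the search: some state of complexity at most `D` has all its `k`-qubit
marginals at trace norm distance less than `θ` from those in `τ`. -/
def SearchAccepts {n : ℕ} (G : SimpleGraph (Fin n)) (D k : ℕ) (θ : ℝ) (τ : Marginals n) : Prop :=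
  ∃ ψ : Bits (Fin n) → ℂ, circuitComplexity G ψ ≤ D ∧
    ∀ s : Finset (Fin n), s.card = k → traceNorm (reduced (pureState ψ) s - τ s) < θ

end ShallowTest

open ShallowTest

/-! Two facts carry the theorem: a shallow pure state is pinned down by its `k`-qubit marginals, and
all these marginals can be estimated from few random Pauli measurements.

For the first, let `ψ = U|0…0⟩` and let `Pᵢ = U |1⟩⟨1|ᵢ Uᴴ`. These projections annihilate `ψ`, and
`Pᵢ` acts only on the light cone of qubit `i`, which has at most `k` qubits (`Local.conj_circuit`,
`card_cone_le_locality`). So if the marginals of `ψ` and `ρ` differ by at most `δ`, then `Tr(Pᵢ ρ) ≤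
δ`. A label other than `0…0` contains some `1`, hence `1 - ⟨ψ|ρ|ψ⟩ ≤ ∑ᵢ Tr(Pᵢ ρ) ≤ nδ`
(`one_sub_le_sum_trace_projOne`), and the Fuchs–van de Graaf inequality gives `‖ψ - ρ‖₁ ≤ 2√(nδ)`
(`traceNorm_sub_le_of_marginals`). An accepted search yields `δ = ε²/(6n) + ε²/(12n) = ε²/(4n)`, so
the bound is exactly `ε`.

For the second, each record gives an unbiased estimate of the marginal on `s`, a tensor product of
one-qubit shadows with squared Hilbert–Schmidt norm `5^k` (`sum_recordProb_mul_shadow`,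
`hsSq_shadow`). Passing to the trace norm costs the dimension `2^k`, whence `10^k`. By Chebyshev a
batch of order `10^k/η²` records is accurate up to `η/2` with high probability; a median over `L`
batches makes the failure probability at most `2^{-L}`, and a union bound over the `k`-sets asks for
`L` of order `log (n choose k)`. -/

namespace ShallowTest
open Matrix
open scoped ComplexOrder MatrixOrder

/-! ### The trace norm -/

section TraceNorm

variable {ι : Type} [Fintype ι] [DecidableEq ι]

/-- Matrices of operator norm at most one. -/
def IsContraction (B : Matrix ι ι ℂ) : Prop := (1 - B * Bᴴ).PosSemidef

theorem exists_eq_mul_conjTranspose {A : Matrix ι ι ℂ} (hA : A.PosSemidef) :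
    ∃ M : Matrix ι ι ℂ, A = M * Mᴴ := by
  obtain ⟨M, hM⟩ := CStarAlgebra.nonneg_iff_eq_mul_star_self.1 hA.nonneg
  exact ⟨M, hM⟩

/-- The squared Hilbert–Schmidt norm. -/
noncomputable def hsSq (A : Matrix ι ι ℂ) : ℝ := ∑ i, ∑ j, ‖A i j‖ ^ 2

omit [DecidableEq ι] in
theorem hsSq_nonneg (A : Matrix ι ι ℂ) : 0 ≤ hsSq A :=
  Finset.sum_nonneg fun _ _ => Finset.sum_nonneg fun _ _ => sq_nonneg _

theorem norm_sum_mul_star_le {κ : Type*} [Fintype κ] (x y : κ → ℂ) :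
    ‖∑ i, x i * star (y i)‖ ≤ √(∑ i, ‖x i‖ ^ 2) * √(∑ i, ‖y i‖ ^ 2) := by
  refine (norm_sum_le _ _).trans ?_
  simp only [norm_mul, norm_star]
  exact Real.sum_mul_le_sqrt_mul_sqrt _ _ _

omit [DecidableEq ι] in
theorem conjTranspose_mul_self_apply (A : Matrix ι ι ℂ) (i : ι) :
    (Aᴴ * A) i i = ((∑ j, ‖A j i‖ ^ 2 : ℝ) : ℂ) := by
  simp [Matrix.mul_apply, mul_comm, Complex.mul_conj, Complex.normSq_eq_norm_sq]

omit [DecidableEq ι] in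
theorem trace_conjTranspose_mul_self (A : Matrix ι ι ℂ) : (Aᴴ * A).trace = (hsSq A : ℂ) := by
  rw [hsSq, Finset.sum_comm]
  simp only [Matrix.trace, Matrix.diag, conjTranspose_mul_self_apply]
  push_cast; rfl

omit [DecidableEq ι] in
theorem norm_trace_mul_conjTranspose_le (X Y : Matrix ι ι ℂ) :
    ‖(X * Yᴴ).trace‖ ≤ √(hsSq X) * √(hsSq Y) := by
  have h := norm_sum_mul_star_le (fun p : ι × ι => X p.1 p.2) (fun p => Y p.1 p.2)
  simpa [Fintype.sum_prod_type, Matrix.trace, Matrix.mul_apply, hsSq] using h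

theorem IsContraction.hsSq_conjTranspose_mul_le {B : Matrix ι ι ℂ} (hB : IsContraction B)
    (Y : Matrix ι ι ℂ) : hsSq (Bᴴ * Y) ≤ hsSq Y := by
  have h := (hB.conjTranspose_mul_mul_same Y).trace_nonneg
  have e : Yᴴ * (1 - B * Bᴴ) * Y = Yᴴ * Y - (Bᴴ * Y)ᴴ * (Bᴴ * Y) := by
    simp [Matrix.mul_sub, Matrix.sub_mul, Matrix.mul_assoc]
  rw [e, Matrix.trace_sub, trace_conjTranspose_mul_self, trace_conjTranspose_mul_self,
    ← Complex.ofReal_sub, Complex.zero_le_real] at h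
  linarith

theorem IsContraction.norm_trace_mul_conjTranspose_le {B : Matrix ι ι ℂ} (hB : IsContraction B)
    (X Y : Matrix ι ι ℂ) : ‖(B * (X * Yᴴ)).trace‖ ≤ √(hsSq X) * √(hsSq Y) := by
  have e : (B * (X * Yᴴ)).trace = (X * (Bᴴ * Y)ᴴ).trace := by
    rw [Matrix.trace_mul_comm]; simp [Matrix.mul_assoc]
  rw [e]
  refine (ShallowTest.norm_trace_mul_conjTranspose_le _ _).trans ?_
  gcongr
  exact hB.hsSq_conjTranspose_mul_le Y

/-- Diagonalization of `Aᴴ A`. -/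
theorem exists_diagonalization (A : Matrix ι ι ℂ) :
    ∃ (V : Matrix ι ι ℂ) (l : ι → ℝ), Vᴴ * V = 1 ∧ V * Vᴴ = 1 ∧ (∀ i, 0 ≤ l i) ∧
      Vᴴ * (Aᴴ * A) * V = diagonal (fun i => (l i : ℂ)) ∧ traceNorm A = ∑ i, √(l i) := by
  let h := Matrix.isHermitian_conjTranspose_mul_self A
  refine ⟨h.eigenvectorUnitary, h.eigenvalues, ?_, ?_, ?_, ?_, rfl⟩
  · exact (Matrix.mem_unitaryGroup_iff').1 h.eigenvectorUnitary.2
  · exact (Matrix.mem_unitaryGroup_iff).1 h.eigenvectorUnitary.2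
  · exact (Matrix.posSemidef_conjTranspose_mul_self A).eigenvalues_nonneg
  · have := h.conjStarAlgAut_star_eigenvectorUnitary
    rw [Unitary.conjStarAlgAut_star_apply] at this
    exact this

/-- Half of the duality between trace norm and operator norm. In an eigenbasis `V` of `Aᴴ A` the
columns of `A V` have norms `√(l i)` and those of `Bᴴ V` norms at most one; Cauchy–Schwarz column by
column does the rest. -/
theorem IsContraction.norm_trace_mul_le {B : Matrix ι ι ℂ} (hB : IsContraction B)
    (A : Matrix ι ι ℂ) : ‖(B * A).trace‖ ≤ traceNorm A := by
  obtain ⟨V, l, h1, h2, h3, h4, h5⟩ := exists_diagonalization A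
  have e : (B * A).trace = ∑ i, ∑ j, (A * V) j i * star ((Bᴴ * V) j i) := by
    calc (B * A).trace = (B * A * (V * Vᴴ)).trace := by rw [h2, Matrix.mul_one]
      _ = ((Bᴴ * V)ᴴ * (A * V)).trace := by
        rw [← Matrix.mul_assoc, Matrix.trace_mul_comm]; simp [Matrix.mul_assoc]
      _ = _ := by
        simp only [Matrix.trace, Matrix.diag]
        refine Finset.sum_congr rfl fun i _ => ?_
        rw [Matrix.mul_apply]
        exact Finset.sum_congr rfl fun j _ => by rw [conjTranspose_apply, mul_comm]
  rw [e, h5]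
  refine (norm_sum_le _ _).trans (Finset.sum_le_sum fun i _ => ?_)
  refine (norm_sum_mul_star_le _ _).trans ?_
  have hA : ∑ j, ‖(A * V) j i‖ ^ 2 = l i := by
    have := conjTranspose_mul_self_apply (A * V) i
    rw [conjTranspose_mul, Matrix.mul_assoc, ← Matrix.mul_assoc Aᴴ, ← Matrix.mul_assoc, h4,
      diagonal_apply_eq] at this
    exact_mod_cast this.symm
  have hV : ∑ j, ‖(Bᴴ * V) j i‖ ^ 2 ≤ 1 := by
    have h := (hB.conjTranspose_mul_mul_same V).diag_nonneg (i := i)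
    have e : Vᴴ * (1 - B * Bᴴ) * V = 1 - (Bᴴ * V)ᴴ * (Bᴴ * V) := by
      simp [Matrix.mul_sub, Matrix.sub_mul, Matrix.mul_assoc, h1]
    rw [e, Matrix.sub_apply, conjTranspose_mul_self_apply, one_apply_eq, ← Complex.ofReal_one,
      ← Complex.ofReal_sub, Complex.zero_le_real] at h
    linarith
  rw [hA]
  calc √(l i) * √(∑ j, ‖(Bᴴ * V) j i‖ ^ 2) ≤ √(l i) * 1 := by
        gcongr; exact Real.sqrt_le_one.2 hV
    _ = _ := mul_one _

/-- The optimal `B` is `(Aᴴ A)^{-1/2} Aᴴ`, the adjoint of the partial isometry in the polar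
decomposition. The convention `0⁻¹ = 0` makes the inverse root a pseudo-inverse, so a kernel of `A`
needs no separate treatment. -/
theorem exists_contraction_trace_eq (A : Matrix ι ι ℂ) :
    ∃ B : Matrix ι ι ℂ, IsContraction B ∧ (B * A).trace = (traceNorm A : ℂ) := by
  obtain ⟨V, l, h1, h2, h3, h4, h5⟩ := exists_diagonalization A
  let S : Matrix ι ι ℂ := diagonal fun i => (((√(l i))⁻¹ : ℝ) : ℂ)
  have hS : Sᴴ = S := by
    simp only [S, diagonal_conjTranspose]
    congr 1; ext i; simp
  have key : ∀ i, (√(l i))⁻¹ * l i = √(l i) := fun i => by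
    rcases eq_or_ne (√(l i)) 0 with h | h
    · simp [h]
    · nth_rw 2 [← Real.mul_self_sqrt (h3 i)]; field_simp
  refine ⟨V * S * Vᴴ * Aᴴ, ?_, ?_⟩
  · have e : 1 - V * S * Vᴴ * Aᴴ * (V * S * Vᴴ * Aᴴ)ᴴ
        = V * (1 - diagonal fun i => ((√(l i) * (√(l i))⁻¹ : ℝ) : ℂ)) * Vᴴ := by
      have : V * S * Vᴴ * Aᴴ * (V * S * Vᴴ * Aᴴ)ᴴ
          = V * (S * (Vᴴ * (Aᴴ * A) * V) * S) * Vᴴ := by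
        simp [Matrix.mul_assoc, hS]
      rw [this, h4, Matrix.mul_sub, Matrix.sub_mul, Matrix.mul_one, h2, diagonal_mul_diagonal,
        diagonal_mul_diagonal]
      congr 4; ext i; rw [← Complex.ofReal_mul (√(l i))⁻¹, key, ← Complex.ofReal_mul]
    unfold IsContraction
    rw [e]
    refine PosSemidef.mul_mul_conjTranspose_same ?_ V
    rw [← diagonal_one, diagonal_sub]
    refine PosSemidef.diagonal fun i => ?_
    show (0 : ℂ) ≤ 1 - ((√(l i) * (√(l i))⁻¹ : ℝ) : ℂ)
    rw [← Complex.ofReal_one, ← Complex.ofReal_sub, Complex.zero_le_real]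
    exact sub_nonneg.2 mul_inv_le_one
  · have : V * S * Vᴴ * Aᴴ * A = V * (S * (Vᴴ * (Aᴴ * A) * V)) * Vᴴ := by
      simp only [Matrix.mul_assoc, h2, Matrix.mul_one]
    rw [this, Matrix.trace_mul_comm, ← Matrix.mul_assoc, h1, Matrix.one_mul, h4,
      diagonal_mul_diagonal, trace_diagonal, h5]
    push_cast
    refine Finset.sum_congr rfl fun i _ => ?_
    rw [← Complex.ofReal_inv, ← Complex.ofReal_mul, key]

/-- The variational form of the trace norm. The triangle inequality, monotonicity under partial
trace and the Fuchs–van de Graaf bound are all derived from it. -/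
theorem traceNorm_le_of_forall {A : Matrix ι ι ℂ} {t : ℝ}
    (h : ∀ B : Matrix ι ι ℂ, IsContraction B → ‖(B * A).trace‖ ≤ t) : traceNorm A ≤ t := by
  obtain ⟨B, hB, e⟩ := exists_contraction_trace_eq A
  have := h B hB
  rw [e, Complex.norm_real] at this
  exact (le_abs_self _).trans this

theorem traceNorm_add_le (A B : Matrix ι ι ℂ) :
    traceNorm (A + B) ≤ traceNorm A + traceNorm B := by
  refine traceNorm_le_of_forall fun C hC => ?_
  rw [Matrix.mul_add, Matrix.trace_add]
  exact (norm_add_le _ _).trans (add_le_add (hC.norm_trace_mul_le A) (hC.norm_trace_mul_le B))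

theorem traceNorm_neg (A : Matrix ι ι ℂ) : traceNorm (-A) = traceNorm A := by
  refine le_antisymm ?_ ?_ <;> refine traceNorm_le_of_forall fun C hC => ?_
  · rw [Matrix.mul_neg, Matrix.trace_neg, norm_neg]; exact hC.norm_trace_mul_le A
  · have := hC.norm_trace_mul_le (-A)
    rwa [Matrix.mul_neg, Matrix.trace_neg, norm_neg] at this

theorem traceNorm_sub_comm (A B : Matrix ι ι ℂ) : traceNorm (A - B) = traceNorm (B - A) := by
  rw [← traceNorm_neg, neg_sub]

theorem traceNorm_sub_le (A B C : Matrix ι ι ℂ) :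
    traceNorm (A - C) ≤ traceNorm (A - B) + traceNorm (B - C) := by
  have := traceNorm_add_le (A - B) (B - C)
  rwa [sub_add_sub_cancel] at this

theorem sq_traceNorm_le (A : Matrix ι ι ℂ) :
    traceNorm A ^ 2 ≤ Fintype.card ι * hsSq A := by
  obtain ⟨V, l, h1, h2, h3, h4, h5⟩ := exists_diagonalization A
  have e : ∑ i, l i = hsSq A := by
    have := congrArg Matrix.trace h4
    rw [Matrix.trace_mul_comm, ← Matrix.mul_assoc, h2, Matrix.one_mul,
      trace_conjTranspose_mul_self, trace_diagonal] at this
    exact_mod_cast this.symm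
  rw [h5, ← e]
  have := sq_sum_le_card_mul_sum_sq (s := Finset.univ) (f := fun i => √(l i))
  simpa [Real.sq_sqrt (h3 _)] using this

omit [DecidableEq ι] in
theorem hsSq_eq_one_of_state {M : Matrix ι ι ℂ} (h : IsState (M * Mᴴ)) : hsSq M = 1 := by
  have := h.2
  rw [Matrix.trace_mul_comm, trace_conjTranspose_mul_self] at this
  exact_mod_cast this

theorem traceNorm_state_le_one {ρ : Matrix ι ι ℂ} (hρ : IsState ρ) : traceNorm ρ ≤ 1 := by
  refine traceNorm_le_of_forall fun B hB => ?_
  obtain ⟨M, rfl⟩ := exists_eq_mul_conjTranspose hρ.1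
  simpa [hsSq_eq_one_of_state hρ] using hB.norm_trace_mul_conjTranspose_le M M

omit [DecidableEq ι] in
theorem hsSq_add (A B : Matrix ι ι ℂ) :
    hsSq (A + B) = hsSq A + hsSq B + 2 * (Aᴴ * B).trace.re := by
  have h : (Bᴴ * A).trace = star (Aᴴ * B).trace := by
    rw [← Matrix.trace_conjTranspose]; simp
  have e : (hsSq (A + B) : ℂ) = hsSq A + hsSq B + ((Aᴴ * B).trace + (Bᴴ * A).trace) := by
    simp only [← trace_conjTranspose_mul_self, conjTranspose_add, Matrix.add_mul, Matrix.mul_add,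
      Matrix.trace_add]
    ring
  rw [h] at e
  have := congrArg Complex.re e
  simp at this
  linarith

omit [DecidableEq ι] in
theorem hsSq_neg (A : Matrix ι ι ℂ) : hsSq (-A) = hsSq A := by simp [hsSq]

/-- The Fuchs–van de Graaf inequality when one of the states is pure. -/
theorem traceNorm_pureState_sub_le {ψ : ι → ℂ} (hψ : star ψ ⬝ᵥ ψ = 1) {ρ : Matrix ι ι ℂ}
    (hρ : IsState ρ) :
    traceNorm (pureState ψ - ρ) ≤ 2 * √(1 - (star ψ ⬝ᵥ (ρ *ᵥ ψ)).re) := by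
  obtain ⟨M, rfl⟩ := exists_eq_mul_conjTranspose hρ.1
  have hM := hsSq_eq_one_of_state hρ
  set F : ℝ := ∑ i, ‖(Mᴴ *ᵥ ψ) i‖ ^ 2 with hF
  have dot : ∀ v : ι → ℂ, star v ⬝ᵥ v = ((∑ i, ‖v i‖ ^ 2 : ℝ) : ℂ) := fun v => by
    simp [dotProduct, mul_comm, Complex.mul_conj, Complex.normSq_eq_norm_sq]
  have hFe : star ψ ⬝ᵥ ((M * Mᴴ) *ᵥ ψ) = (F : ℂ) := by
    rw [hF, ← dot, ← Matrix.mulVec_mulVec, star_mulVec, conjTranspose_conjTranspose,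
      Matrix.dotProduct_mulVec]
  have hF0 : 0 ≤ F := Finset.sum_nonneg fun _ _ => sq_nonneg _
  rw [hFe, Complex.ofReal_re]
  -- a unit vector `w` along `Mᴴ ψ`
  obtain ⟨w, hw1, hw2⟩ : ∃ w : ι → ℂ, star w ⬝ᵥ w = 1 ∧ star ψ ⬝ᵥ (M *ᵥ w) = ((√F : ℝ) : ℂ) := by
    have hsw : ∀ w : ι → ℂ, star ψ ⬝ᵥ (M *ᵥ w) = star (Mᴴ *ᵥ ψ) ⬝ᵥ w := fun w => by
      rw [star_mulVec, conjTranspose_conjTranspose, Matrix.dotProduct_mulVec]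
    rcases eq_or_lt_of_le hF0 with h0 | h0
    · refine ⟨ψ, hψ, ?_⟩
      have hz : Mᴴ *ᵥ ψ = 0 := by
        rw [← dotProduct_star_self_eq_zero, dot, ← hF, ← h0, Complex.ofReal_zero]
      rw [hsw, hz, ← h0]; simp
    · have hs : √F ≠ 0 := (Real.sqrt_pos.2 h0).ne'
      have hFF : (√F)⁻¹ * F = √F := by
        nth_rw 2 [← Real.mul_self_sqrt hF0]; field_simp
      refine ⟨(((√F)⁻¹ : ℝ) : ℂ) • (Mᴴ *ᵥ ψ), ?_, ?_⟩
      · rw [star_smul, smul_dotProduct, dotProduct_smul, dot, ← hF, smul_eq_mul, smul_eq_mul,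
          ← Complex.ofReal_mul, hFF]
        simp [hs]
      · rw [hsw, dotProduct_smul, dot, ← hF, smul_eq_mul, ← Complex.ofReal_mul, hFF]
  -- `N` and `M` play the role of purifications of the two states. The choice of `w` aligns them, as
  -- in Uhlmann's theorem: their Hilbert–Schmidt overlap is the real number `√F`.
  set N : Matrix ι ι ℂ := vecMulVec ψ (star w) with hN
  have hNN : N * Nᴴ = pureState ψ := by
    rw [hN, conjTranspose_vecMulVec, star_star, vecMulVec_mul_vecMulVec, hw1]
    simp [pureState]
  have hN1 : hsSq N = 1 := by
    have := trace_conjTranspose_mul_self N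
    rw [Matrix.trace_mul_comm, hNN, pureState, trace_vecMulVec, dotProduct_comm, hψ] at this
    exact_mod_cast this.symm
  have hc : (Nᴴ * M).trace = ((√F : ℝ) : ℂ) := by
    rw [hN, conjTranspose_vecMulVec, star_star, vecMulVec_mul, trace_vecMulVec, dotProduct_comm,
      ← hw2, ← Matrix.dotProduct_mulVec]
  have hp : hsSq (N + M) = 2 + 2 * √F := by
    rw [hsSq_add, hN1, hM, hc, Complex.ofReal_re]; ring
  have hm : hsSq (N - M) = 2 - 2 * √F := by
    rw [sub_eq_add_neg, hsSq_add, hsSq_neg, hN1, hM, Matrix.mul_neg, Matrix.trace_neg, hc,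
      Complex.neg_re, Complex.ofReal_re]
    ring
  -- Polarization: each product has one factor `N - M`, which is small when `F` is near one.
  have hdec : pureState ψ - M * Mᴴ
      = (1 / 2 : ℂ) • ((N + M) * (N - M)ᴴ + (N - M) * (N + M)ᴴ) := by
    rw [← hNN]
    simp only [conjTranspose_add, conjTranspose_sub, Matrix.add_mul, Matrix.mul_add,
      Matrix.sub_mul, Matrix.mul_sub]
    module
  refine traceNorm_le_of_forall fun B hB => ?_
  rw [hdec, Matrix.mul_smul, Matrix.trace_smul, norm_smul, Matrix.mul_add, Matrix.trace_add]
  have b1 := hB.norm_trace_mul_conjTranspose_le (N + M) (N - M)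
  have b2 := hB.norm_trace_mul_conjTranspose_le (N - M) (N + M)
  have b3 := norm_add_le (B * ((N + M) * (N - M)ᴴ)).trace (B * ((N - M) * (N + M)ᴴ)).trace
  have e : √(hsSq (N + M)) * √(hsSq (N - M)) = 2 * √(1 - F) := by
    rw [← Real.sqrt_mul (hsSq_nonneg _), hp, hm]
    have : (2 + 2 * √F) * (2 - 2 * √F) = 2 ^ 2 * (1 - F) := by
      nlinarith [Real.mul_self_sqrt hF0]
    rw [this, Real.sqrt_mul (by norm_num), Real.sqrt_sq (by norm_num)]
  rw [mul_comm (√(hsSq (N - M)))] at b2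
  rw [e] at b1 b2
  have : ‖(1 / 2 : ℂ)‖ = 1 / 2 := by norm_num
  rw [this]
  linarith

end TraceNorm

/-! ### Operators that act on few qubits -/

section Local

variable {n : ℕ}

/-- A label of the register is a label of `s` together with a label of the complement. -/
def glueEquiv (s : Finset (Fin n)) :
    Bits {i // i ∈ s} × Bits {i // i ∉ s} ≃ Bits (Fin n) where
  toFun p := glue s p.1 p.2
  invFun x := (fun i => x i, fun i => x i)
  left_inv p := by
    ext i
    · simp [glue, i.2]
    · simp [glue, i.2]
  right_inv x := by ext i; simp [glue]

theorem sum_glue {M : Type*} [AddCommMonoid M] (s : Finset (Fin n)) (f : Bits (Fin n) → M) :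
    ∑ x, f x = ∑ a, ∑ z, f (glue s a z) := by
  rw [← (glueEquiv s).sum_comp, Fintype.sum_prod_type]; rfl

/-- The operator `K ⊗ 1` that acts as `K` on the qubits in `s`. -/
def extend (s : Finset (Fin n)) (K : Matrix (Bits {i // i ∈ s}) (Bits {i // i ∈ s}) ℂ) :
    Matrix (Bits (Fin n)) (Bits (Fin n)) ℂ :=
  fun x y => if ∀ l, l ∉ s → x l = y l then K (fun i => x i) (fun i => y i) else 0

theorem glue_of_mem (s : Finset (Fin n)) (a : Bits {i // i ∈ s}) (z : Bits {i // i ∉ s})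
    {i : Fin n} (h : i ∈ s) : glue s a z i = a ⟨i, h⟩ := by simp [glue, h]

theorem glue_of_notMem (s : Finset (Fin n)) (a : Bits {i // i ∈ s}) (z : Bits {i // i ∉ s})
    {i : Fin n} (h : i ∉ s) : glue s a z i = z ⟨i, h⟩ := by simp [glue, h]

theorem glue_restrict (s : Finset (Fin n)) (x : Bits (Fin n)) :
    glue s (fun i => x i) (fun i => x i) = x := (glueEquiv s).right_inv x

theorem extend_glue (s : Finset (Fin n)) (K : Matrix (Bits {i // i ∈ s}) (Bits {i // i ∈ s}) ℂ)
    (a b z w) : extend s K (glue s a z) (glue s b w) = if z = w then K a b else 0 := by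
  have h1 : ∀ a z, (fun i : {i // i ∈ s} => glue s a z i) = a := fun a z => by
    ext i; simp [glue, i.2]
  have h2 : (∀ l, l ∉ s → glue s a z l = glue s b w l) ↔ z = w := by
    refine ⟨fun h => ?_, ?_⟩
    · ext i
      have := h i i.2
      simp only [glue_of_notMem s _ _ i.2] at this
      rw [this]
    · rintro rfl l hl
      rw [glue_of_notMem _ _ _ hl, glue_of_notMem _ _ _ hl]
  simp only [extend, h1, h2]

theorem ext_glue {s : Finset (Fin n)} {A B : Matrix (Bits (Fin n)) (Bits (Fin n)) ℂ}
    (h : ∀ a b z w, A (glue s a z) (glue s b w) = B (glue s a z) (glue s b w)) : A = B := by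
  ext x y
  rw [← glue_restrict s x, ← glue_restrict s y, h]

variable (s : Finset (Fin n)) (K L : Matrix (Bits {i // i ∈ s}) (Bits {i // i ∈ s}) ℂ)

theorem extend_mul : extend s (K * L) = extend s K * extend s L := by
  refine ext_glue (s := s) fun a b z w => ?_
  rw [Matrix.mul_apply, sum_glue s]
  simp only [extend_glue, Matrix.mul_apply]
  split_ifs with h <;> simp [h]

theorem extend_one : extend s 1 = 1 := by
  refine ext_glue (s := s) fun a b z w => ?_
  rw [extend_glue, Matrix.one_apply, Matrix.one_apply]
  have : glue s a z = glue s b w ↔ a = b ∧ z = w :=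
    (glueEquiv s).injective.eq_iff (a := (a, z)) (b := (b, w)) |>.trans Prod.mk_inj
  simp only [this]
  split_ifs <;> simp_all

theorem extend_sub : extend s (K - L) = extend s K - extend s L := by
  refine ext_glue (s := s) fun a b z w => ?_
  simp only [extend_glue, Matrix.sub_apply]
  split_ifs <;> simp

theorem extend_conjTranspose : extend s Kᴴ = (extend s K)ᴴ := by
  refine ext_glue (s := s) fun a b z w => ?_
  simp only [extend_glue, Matrix.conjTranspose_apply, eq_comm (a := z)]
  split_ifs <;> simp

theorem extend_submatrix : (extend s K).submatrix (fun a => glue s a fun _ => 0)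
    (fun a => glue s a fun _ => 0) = K := by
  ext a b; simp [extend_glue]

-- `K` is a principal submatrix of `K ⊗ 1`, and `K ⊗ 1` inherits a factorization `M Mᴴ` from `K`.
-- Both directions are needed: one to test reduced operators, one to descend from the register to a
-- light cone.
variable {K} in
theorem posSemidef_extend : (extend s K).PosSemidef ↔ K.PosSemidef := by
  refine ⟨fun h => ?_, fun h => ?_⟩
  · have := h.submatrix (fun a => glue s a fun _ => 0)
    rwa [extend_submatrix] at this
  · obtain ⟨M, rfl⟩ := exists_eq_mul_conjTranspose h
    rw [extend_mul, extend_conjTranspose]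
    exact Matrix.posSemidef_self_mul_conjTranspose _

variable {K} in
theorem isContraction_extend : IsContraction (extend s K) ↔ IsContraction K := by
  unfold IsContraction
  rw [← extend_conjTranspose, ← extend_mul, ← extend_one s, ← extend_sub, posSemidef_extend]

/-- The partial trace is dual to `K ↦ K ⊗ 1`; this is how expectations of local operators are read
off from marginals. -/
theorem trace_extend_mul (ρ : Matrix (Bits (Fin n)) (Bits (Fin n)) ℂ) :
    (extend s K * ρ).trace = (K * reduced ρ s).trace := by
  simp only [Matrix.trace, Matrix.diag, Matrix.mul_apply]
  rw [sum_glue s]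
  refine Finset.sum_congr rfl fun a _ => ?_
  simp only [sum_glue s, extend_glue, reduced, Finset.mul_sum, ite_mul, zero_mul,
    Finset.sum_ite_eq, Finset.mem_univ, if_true]
  rw [Finset.sum_comm]

theorem reduced_sub (ρ σ : Matrix (Bits (Fin n)) (Bits (Fin n)) ℂ) :
    reduced (ρ - σ) s = reduced ρ s - reduced σ s := by
  ext a b; simp [reduced]

theorem reduced_posSemidef {ρ : Matrix (Bits (Fin n)) (Bits (Fin n)) ℂ} (h : ρ.PosSemidef) :
    (reduced ρ s).PosSemidef := by
  have : reduced ρ s = ∑ z : Bits {i // i ∉ s},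
      ρ.submatrix (fun a => glue s a z) (fun a => glue s a z) := by
    ext a b; simp [reduced, Matrix.sum_apply]
  rw [this]
  exact Matrix.posSemidef_sum _ fun z _ => h.submatrix _

theorem isState_reduced {ρ : Matrix (Bits (Fin n)) (Bits (Fin n)) ℂ} (h : IsState ρ) :
    IsState (reduced ρ s) := by
  refine ⟨reduced_posSemidef s h.1, ?_⟩
  have := trace_extend_mul s 1 ρ
  rwa [extend_one, Matrix.one_mul, Matrix.one_mul, h.2, eq_comm] at this

/-- The partial trace does not increase the trace norm. -/
theorem traceNorm_reduced_le (A : Matrix (Bits (Fin n)) (Bits (Fin n)) ℂ) :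
    traceNorm (reduced A s) ≤ traceNorm A := by
  refine traceNorm_le_of_forall fun B hB => ?_
  rw [← trace_extend_mul]
  exact ((isContraction_extend s).2 hB).norm_trace_mul_le A

/-- The operators that act as the identity outside `s`. -/
def Local (s : Finset (Fin n)) (A : Matrix (Bits (Fin n)) (Bits (Fin n)) ℂ) : Prop :=
  ∃ K, A = extend s K

variable {s}

theorem Local.mul {A B : Matrix (Bits (Fin n)) (Bits (Fin n)) ℂ} (hA : Local s A)
    (hB : Local s B) : Local s (A * B) := by
  obtain ⟨K, rfl⟩ := hA
  obtain ⟨L, rfl⟩ := hB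
  exact ⟨K * L, (extend_mul s K L).symm⟩

theorem Local.conjTranspose {A : Matrix (Bits (Fin n)) (Bits (Fin n)) ℂ} (hA : Local s A) :
    Local s Aᴴ := by
  obtain ⟨K, rfl⟩ := hA
  exact ⟨Kᴴ, (extend_conjTranspose s K).symm⟩

theorem Local.mono {t : Finset (Fin n)} (hst : s ⊆ t)
    {A : Matrix (Bits (Fin n)) (Bits (Fin n)) ℂ} (hA : Local s A) : Local t A := by
  obtain ⟨K, rfl⟩ := hA
  refine ⟨(extend s K).submatrix (fun a => glue t a fun _ => 0) (fun a => glue t a fun _ => 0), ?_⟩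
  ext x y
  have hx : ∀ x : Bits (Fin n), (fun i : {i // i ∈ s} =>
      glue t (fun i : {i // i ∈ t} => x i) (fun _ => 0) i) = fun i : {i // i ∈ s} => x i :=
    fun x => by ext i; rw [glue_of_mem _ _ _ (hst i.2)]
  simp only [extend, submatrix_apply, hx]
  rw [← ite_and]
  refine if_congr ⟨fun h => ⟨fun l hl => h l fun hs => hl (hst hs), fun l hl => ?_⟩, ?_⟩ rfl rfl
  · by_cases hlt : l ∈ t
    · rw [glue_of_mem _ _ _ hlt, glue_of_mem _ _ _ hlt]; exact h l hl
    · rw [glue_of_notMem _ _ _ hlt, glue_of_notMem _ _ _ hlt]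
  · rintro ⟨h1, h2⟩ l hl
    by_cases hlt : l ∈ t
    · have := h2 l hl
      rwa [glue_of_mem _ _ _ hlt, glue_of_mem _ _ _ hlt] at this
    · exact h1 l hlt

theorem extend_mul_extend_apply {t : Finset (Fin n)} (hst : Disjoint s t)
    (K : Matrix (Bits {i // i ∈ s}) (Bits {i // i ∈ s}) ℂ)
    (L : Matrix (Bits {i // i ∈ t}) (Bits {i // i ∈ t}) ℂ) (x y : Bits (Fin n)) :
    (extend s K * extend t L) x y = if ∀ l, l ∉ s → l ∉ t → x l = y l then
      K (fun i => x i) (fun i => y i) * L (fun i => x i) (fun i => y i) else 0 := by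
  rw [Matrix.mul_apply]
  -- The first factor changes only qubits of `s`, the second only those of `t`, so a single
  -- intermediate label can contribute.
  rw [Finset.sum_eq_single (fun l => if l ∈ s then y l else x l)]
  · have h1 : (fun i : {i // i ∈ s} => if (i : Fin n) ∈ s then y i else x i) =
        fun i : {i // i ∈ s} => y i := by
      ext i; simp [i.2]
    have h2 : (fun i : {i // i ∈ t} => if (i : Fin n) ∈ s then y i else x i) =
        fun i : {i // i ∈ t} => x i := by
      ext i; simp [Finset.disjoint_right.1 hst i.2]
    simp only [extend, h1, h2]
    rw [if_pos (fun l hl => by simp [hl]), mul_ite, mul_zero]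
    refine if_congr ⟨fun h l hs ht => ?_, fun h l ht => ?_⟩ rfl rfl
    · simpa [hs] using h l ht
    · by_cases hs : l ∈ s
      · simp [hs]
      · simpa [hs] using h l hs ht
  · intro w _ hw
    by_contra hne
    obtain ⟨h1, h2⟩ := mul_ne_zero_iff.1 hne
    simp only [extend, ne_eq, ite_eq_right_iff, Classical.not_imp] at h1 h2
    refine hw (funext fun l => ?_)
    by_cases hs : l ∈ s
    · simp [hs, h2.1 l (Finset.disjoint_left.1 hst hs)]
    · simp [hs, h1.1 l hs]
  · simp

theorem Local.commute {t : Finset (Fin n)} (hst : Disjoint s t)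
    {A B : Matrix (Bits (Fin n)) (Bits (Fin n)) ℂ} (hA : Local s A) (hB : Local t B) :
    A * B = B * A := by
  obtain ⟨K, rfl⟩ := hA
  obtain ⟨L, rfl⟩ := hB
  ext x y
  rw [extend_mul_extend_apply hst, extend_mul_extend_apply hst.symm]
  refine if_congr ⟨fun h l ht hs => h l hs ht, fun h l hs ht => h l ht hs⟩ (mul_comm _ _) rfl

end Local

/-! ### Light cones -/

section LightCone

variable {n : ℕ} {G : SimpleGraph (Fin n)}

theorem Gate.fst_mem (g : Gate G) : g.fst ∈ g.support := by simp [Gate.support]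

theorem Gate.snd_mem (g : Gate G) : g.snd ∈ g.support := by simp [Gate.support]

/-- Labels of the two qubits of a gate. -/
def Gate.labelEquiv (g : Gate G) : Bits {i // i ∈ g.support} ≃ Fin 2 × Fin 2 where
  toFun a := (a ⟨g.fst, g.fst_mem⟩, a ⟨g.snd, g.snd_mem⟩)
  invFun p i := if (i : Fin n) = g.fst then p.1 else p.2
  left_inv a := by
    ext ⟨i, hi⟩
    rcases Finset.mem_insert.1 hi with rfl | h
    · simp
    · rw [Finset.mem_singleton] at h
      subst h
      simp [g.adj.ne']
  right_inv p := by ext <;> simp [g.adj.ne']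

theorem Gate.toMatrix_eq_extend (g : Gate G) :
    g.toMatrix = extend g.support (g.V.submatrix g.labelEquiv g.labelEquiv) := rfl

theorem Gate.isLocal (g : Gate G) : Local g.support g.toMatrix := ⟨_, g.toMatrix_eq_extend⟩

theorem Gate.mul_conjTranspose (g : Gate G) : g.toMatrix * g.toMatrixᴴ = 1 := by
  rw [g.toMatrix_eq_extend, ← extend_conjTranspose, ← extend_mul, conjTranspose_submatrix,
    submatrix_mul_equiv]
  have := (Matrix.mem_unitaryGroup_iff).1 g.unitary
  rw [star_eq_conjTranspose] at this
  rw [this, submatrix_one_equiv, extend_one]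

/-- The matching of the qubits defined by a list of gates. -/
def partner : List (Gate G) → Fin n → Fin n
  | [], p => p
  | g :: gs, p => if p = g.fst then g.snd else if p = g.snd then g.fst else partner gs p

theorem partner_eq_or_adj (gs : List (Gate G)) (p : Fin n) :
    partner gs p = p ∨ G.Adj p (partner gs p) := by
  induction gs with
  | nil => simp [partner]
  | cons g gs ih =>
    simp only [partner]
    split_ifs with h1 h2
    · exact Or.inr (h1 ▸ g.adj)
    · exact Or.inr (h2 ▸ g.adj.symm)
    · exact ih

theorem partner_of_notMem {gs : List (Gate G)} {p : Fin n}
    (h : ∀ g ∈ gs, p ∉ g.support) : partner gs p = p := by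
  induction gs with
  | nil => rfl
  | cons g gs ih =>
    have := h g List.mem_cons_self
    simp only [Gate.support, Finset.mem_insert, Finset.mem_singleton, not_or] at this
    rw [partner, if_neg this.1, if_neg this.2]
    exact ih fun g' hg' => h g' (List.mem_cons_of_mem _ hg')

theorem partner_mem_support {gs : List (Gate G)} {p : Fin n} :
    partner gs p = p ∨ ∃ g ∈ gs, p ∈ g.support ∧ partner gs p ∈ g.support := by
  induction gs with
  | nil => simp [partner]
  | cons g gs ih =>
    simp only [partner]
    split_ifs with h1 h2
    · exact Or.inr ⟨g, by simp, h1 ▸ g.fst_mem, g.snd_mem⟩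
    · exact Or.inr ⟨g, by simp, h2 ▸ g.snd_mem, g.fst_mem⟩
    · rcases ih with h | ⟨g', hg', h⟩
      · exact Or.inl h
      · exact Or.inr ⟨g', List.mem_cons_of_mem _ hg', h⟩

/-- A gate that misses `s` commutes with the operator conjugated so far and cancels against its
adjoint. A gate that meets `s` enlarges the support at most by the partner of a qubit of `s`. -/
theorem Local.conj_gates {gs : List (Gate G)}
    (hd : gs.Pairwise fun g h => Disjoint g.support h.support) {s : Finset (Fin n)}
    {A : Matrix (Bits (Fin n)) (Bits (Fin n)) ℂ} (hA : Local s A) :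
    Local (s ∪ s.image (partner gs))
      ((gs.map Gate.toMatrix).prod * A * ((gs.map Gate.toMatrix).prod)ᴴ) := by
  induction gs with
  | nil => simpa using hA.mono Finset.subset_union_left
  | cons g gs ih =>
    rw [List.pairwise_cons] at hd
    have hB := ih hd.2
    set B := (gs.map Gate.toMatrix).prod * A * ((gs.map Gate.toMatrix).prod)ᴴ
    have e : ((g :: gs).map Gate.toMatrix).prod * A * (((g :: gs).map Gate.toMatrix).prod)ᴴ
        = g.toMatrix * B * g.toMatrixᴴ := by
      simp [B, Matrix.mul_assoc]
    rw [e]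
    by_cases hs : Disjoint g.support s
    · have hdis : Disjoint g.support (s ∪ s.image (partner gs)) := by
        refine Finset.disjoint_union_right.2 ⟨hs, Finset.disjoint_right.2 fun q hq hqg => ?_⟩
        obtain ⟨p, hp, rfl⟩ := Finset.mem_image.1 hq
        rcases partner_mem_support (gs := gs) (p := p) with h | ⟨g', hg', -, h⟩
        · rw [h] at hqg; exact Finset.disjoint_left.1 hs hqg hp
        · exact Finset.disjoint_left.1 (hd.1 g' hg') hqg h
      rw [Local.commute hdis g.isLocal hB, Matrix.mul_assoc, g.mul_conjTranspose, Matrix.mul_one]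
      refine hB.mono (Finset.union_subset_union_right fun q hq => ?_)
      obtain ⟨p, hp, rfl⟩ := Finset.mem_image.1 hq
      have hpg : p ∉ g.support := Finset.disjoint_right.1 hs hp
      simp only [Gate.support, Finset.mem_insert, Finset.mem_singleton, not_or] at hpg
      refine Finset.mem_image.2 ⟨p, hp, ?_⟩
      rw [partner, if_neg hpg.1, if_neg hpg.2]
    · set t := s ∪ s.image (partner (g :: gs)) with ht
      have h1 : g.support ⊆ t := by
        obtain ⟨p, hpg, hp⟩ := Finset.not_disjoint_iff.1 hs
        have hq : partner (g :: gs) p ∈ t :=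
          Finset.mem_union_right _ (Finset.mem_image_of_mem _ hp)
        have hpt : p ∈ t := Finset.mem_union_left _ hp
        simp only [Gate.support, Finset.mem_insert, Finset.mem_singleton] at hpg
        rw [Gate.support, Finset.insert_subset_iff, Finset.singleton_subset_iff]
        rcases hpg with rfl | rfl
        · rw [partner, if_pos rfl] at hq; exact ⟨hpt, hq⟩
        · rw [partner, if_neg g.adj.ne', if_pos rfl] at hq; exact ⟨hq, hpt⟩
      have h2 : s ∪ s.image (partner gs) ⊆ t := by
        refine Finset.union_subset Finset.subset_union_left fun q hq => ?_
        obtain ⟨p, hp, rfl⟩ := Finset.mem_image.1 hq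
        by_cases hpg : p ∈ g.support
        · rw [partner_of_notMem fun g' hg' => Finset.disjoint_left.1 (hd.1 g' hg') hpg]
          exact Finset.mem_union_left _ hp
        · simp only [Gate.support, Finset.mem_insert, Finset.mem_singleton, not_or] at hpg
          refine Finset.mem_union_right _ (Finset.mem_image.2 ⟨p, hp, ?_⟩)
          rw [partner, if_neg hpg.1, if_neg hpg.2]
      exact ((g.isLocal.mono h1).mul (hB.mono h2)).mul (g.isLocal.mono h1).conjTranspose

theorem Layer.mul_conjTranspose (L : Layer G) : L.toMatrix * L.toMatrixᴴ = 1 := by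
  unfold Layer.toMatrix
  induction L.gates with
  | nil => simp
  | cons g gs ih =>
    rw [List.map_cons, List.prod_cons, conjTranspose_mul, Matrix.mul_assoc,
      ← Matrix.mul_assoc _ _ (g.toMatrixᴴ), ih, Matrix.one_mul, g.mul_conjTranspose]

/-- The light cone of a set of qubits. -/
def cone : Circuit G → Finset (Fin n) → Finset (Fin n)
  | [], s => s
  | L :: C, s => cone C (s ∪ s.image (partner L.gates))

/-- The unitary of a circuit. -/
noncomputable def Circuit.toMatrix : Circuit G → Matrix (Bits (Fin n)) (Bits (Fin n)) ℂ
  | [] => 1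
  | L :: C => Circuit.toMatrix C * L.toMatrix

theorem Circuit.mul_conjTranspose (C : Circuit G) :
    Circuit.toMatrix C * (Circuit.toMatrix C)ᴴ = 1 := by
  induction C with
  | nil => simp [Circuit.toMatrix]
  | cons L C ih =>
    rw [Circuit.toMatrix, conjTranspose_mul, Matrix.mul_assoc, ← Matrix.mul_assoc L.toMatrix,
      L.mul_conjTranspose, Matrix.one_mul, ih]

theorem Circuit.output_eq (C : Circuit G) :
    C.output = Circuit.toMatrix C *ᵥ ketZero n := by
  unfold Circuit.output
  generalize ketZero n = v
  induction C generalizing v with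
  | nil => simp [Circuit.toMatrix]
  | cons L C ih => rw [List.foldl_cons, ih, Circuit.toMatrix, Matrix.mulVec_mulVec]

theorem Local.conj_circuit (C : Circuit G) {s : Finset (Fin n)}
    {A : Matrix (Bits (Fin n)) (Bits (Fin n)) ℂ} (hA : Local s A) :
    Local (cone C s) (Circuit.toMatrix C * A * (Circuit.toMatrix C)ᴴ) := by
  induction C generalizing s A with
  | nil => simpa [Circuit.toMatrix, cone] using hA
  | cons L C ih =>
    have := ih (hA.conj_gates L.disjoint)
    rw [Circuit.toMatrix, conjTranspose_mul]
    simpa only [Layer.toMatrix, Matrix.mul_assoc, cone] using this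

/-- `cone` recurses on the first layer, but the size bounds follow the growth of the cone under one
more final layer. -/
theorem cone_concat (C : Circuit G) (L : Layer G) (s : Finset (Fin n)) :
    cone (C ++ [L]) s = cone C s ∪ (cone C s).image (partner L.gates) := by
  induction C generalizing s with
  | nil => rfl
  | cons L' C ih => exact ih _

theorem card_cone_le_two_pow (C : Circuit G) (i : Fin n) :
    (cone C {i}).card ≤ 2 ^ C.length := by
  induction C using List.reverseRecOn with
  | nil => simp [cone]
  | append_singleton C L ih =>
    rw [cone_concat, List.length_append, List.length_singleton, pow_succ]
    have h1 := Finset.card_union_le (cone C {i}) ((cone C {i}).image (partner L.gates))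
    have h2 : ((cone C {i}).image (partner L.gates)).card ≤ (cone C {i}).card :=
      Finset.card_image_le
    omega

/-- The first layer turns a site into at most a pair of neighbours, gaining one site; each later
layer extends the interval by at most one site at each end. This gives `2D` in place of `2D + 1`,
and is why the empty circuit is excluded. -/
theorem cone_subset_interval (C : Circuit (SimpleGraph.pathGraph n)) (i : Fin n)
    (hC : C ≠ []) :
    ∃ a : ℤ, ∀ p ∈ cone C {i}, a ≤ (p : ℕ) ∧ ((p : ℕ) : ℤ) < a + 2 * C.length := by
  induction C using List.reverseRecOn with
  | nil => exact absurd rfl hC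
  | append_singleton C L ih =>
    have adj := partner_eq_or_adj L.gates
    simp only [SimpleGraph.pathGraph_adj] at adj
    rw [cone_concat]
    rcases eq_or_ne C [] with rfl | hne
    · refine ⟨min (i : ℕ) (partner L.gates i : ℕ), fun p hp => ?_⟩
      simp only [cone, Finset.image_singleton, Finset.mem_union, Finset.mem_singleton] at hp
      have h := adj i
      rw [Fin.ext_iff] at h
      simp only [List.nil_append, List.length_singleton]
      rcases hp with rfl | rfl <;> omega
    · obtain ⟨a, ha⟩ := ih hne
      refine ⟨a - 1, fun p hp => ?_⟩
      rw [List.length_append, List.length_singleton]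
      push_cast
      rcases Finset.mem_union.1 hp with h | h
      · have := ha p h; omega
      · obtain ⟨q, hq, rfl⟩ := Finset.mem_image.1 h
        have h1 := ha q hq
        have h2 := adj q
        rw [Fin.ext_iff] at h2
        omega

theorem card_cone_le_two_mul (C : Circuit (SimpleGraph.pathGraph n)) (i : Fin n)
    (hC : C ≠ []) : (cone C {i}).card ≤ 2 * C.length := by
  obtain ⟨a, ha⟩ := cone_subset_interval C i hC
  have : (cone C {i}).card ≤ (Finset.Ico a (a + 2 * C.length)).card := by
    refine Finset.card_le_card_of_injOn (fun p => ((p : ℕ) : ℤ)) (fun p hp => ?_) ?_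
    · simpa using ha p hp
    · intro p _ q _ h
      exact Fin.ext (by simpa using h)
  rw [Int.card_Ico] at this
  omega

theorem reachable_cone (site : Fin n ↪ ℤ × ℤ) (C : Circuit (squareLattice.comap site))
    (i : Fin n) : Reachable C.length ((cone C {i}).image fun p => site p - site i) := by
  induction C using List.reverseRecOn with
  | nil => simp [cone, Reachable, Prod.ext_iff]
  | append_singleton C L ih =>
    rw [List.length_append, List.length_singleton, cone_concat]
    -- The matching of the layer, transported to the lattice with `site i` moved to the origin;
    -- points that carry no qubit stay fixed.
    refine ⟨_, ih, fun v => if h : ∃ p, site p - site i = v then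
      site (partner L.gates h.choose) - site i else v, fun v _ => ?_, ?_⟩
    · simp only
      split_ifs with h
      · generalize h.choose_spec = hp
        revert hp
        generalize h.choose = p
        rintro rfl
        rcases partner_eq_or_adj L.gates p with h' | h'
        · rw [h']; exact Or.inl rfl
        · right
          simpa [squareLattice] using h'
      · exact Or.inl rfl
    · rw [Finset.image_union, Finset.image_image, Finset.image_image]
      congr 1
      refine Finset.image_congr fun p _ => ?_
      have h : ∃ q, site q - site i = site p - site i := ⟨p, rfl⟩
      have hq : h.choose = p := site.injective (sub_left_injective h.choose_spec)
      simp only [Function.comp_apply]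
      rw [dif_pos h, hq]

theorem Reachable.mono {D D' : ℕ} (h : D ≤ D') {S : Finset (ℤ × ℤ)} (hS : Reachable D S) :
    Reachable D' S := by
  induction h with
  | refl => exact hS
  | step _ ih => exact ⟨S, ih, id, fun _ _ => Or.inl rfl, by simp⟩

theorem card_cone_le_gammaTwo (site : Fin n ↪ ℤ × ℤ) (C : Circuit (squareLattice.comap site))
    (i : Fin n) {D : ℕ} (h : C.length ≤ D) : (cone C {i}).card ≤ gammaTwo D := by
  have := card_le_gammaTwo ((reachable_cone site C i).mono h)
  rwa [Finset.card_image_of_injective] at this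
  exact fun p q h => site.injective (sub_left_injective h)

theorem card_cone_le_locality (g : Geometry n) (C : Circuit g.graph) (i : Fin n) {D : ℕ}
    (h : C.length ≤ D) (hD : 1 ≤ g.locality D) : (cone C {i}).card ≤ g.locality D := by
  match g with
  | .general => exact (card_cone_le_two_pow C i).trans (Nat.pow_le_pow_right (by norm_num) h)
  | .chain =>
    -- Without layers the cone is one qubit, and only `1 ≤ g.locality D` covers this case.
    rcases eq_or_ne C [] with rfl | hC
    · simpa [cone] using hD
    · exact (card_cone_le_two_mul C i hC).trans (Nat.mul_le_mul_left 2 h)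
  | .square site => exact card_cone_le_gammaTwo site C i h

theorem exists_circuit {ψ : Bits (Fin n) → ℂ} {D : ℕ} (h : circuitComplexity G ψ ≤ D) :
    ∃ C : Circuit G, C.output = ψ ∧ C.length ≤ D := by
  -- A strict bound on the infimum exhibits a circuit; integrality of the depth then returns `≤ D`.
  have h' : circuitComplexity G ψ < (D + 1 : ℕ) :=
    lt_of_le_of_lt h (by exact_mod_cast Nat.lt_succ_self D)
  simp only [circuitComplexity, iInf_lt_iff] at h'
  obtain ⟨C, hC, hl⟩ := h'
  exact ⟨C, hC, Nat.lt_succ_iff.1 (by exact_mod_cast hl)⟩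

end LightCone

/-! ### Shallow states are determined by their marginals -/

section Parent

variable {n : ℕ} {G : SimpleGraph (Fin n)}

/-- The projection onto `|1⟩` on the qubit `i`. -/
def projOne (i : Fin n) : Matrix (Bits (Fin n)) (Bits (Fin n)) ℂ :=
  diagonal fun x => if x i = 1 then 1 else 0

theorem projOne_isLocal (i : Fin n) : Local {i} (projOne i) := by
  refine ⟨diagonal fun a => if a ⟨i, Finset.mem_singleton_self i⟩ = 1 then 1 else 0, ?_⟩
  ext x y
  have h : x = y ↔ (∀ l, l ∉ ({i} : Finset (Fin n)) → x l = y l) ∧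
      (fun j : {j // j ∈ ({i} : Finset (Fin n))} => x j) =
        fun j : {j // j ∈ ({i} : Finset (Fin n))} => y j := by
    refine ⟨by rintro rfl; simp, fun ⟨h1, h2⟩ => funext fun l => ?_⟩
    by_cases hl : l ∈ ({i} : Finset (Fin n))
    · exact congrFun h2 ⟨l, hl⟩
    · exact h1 l hl
  simp only [projOne, extend, diagonal_apply, h, ite_and]

theorem projOne_mul_conjTranspose (i : Fin n) : projOne i * (projOne i)ᴴ = projOne i := by
  rw [projOne, diagonal_conjTranspose, diagonal_mul_diagonal]
  congr 1; ext x; simp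

theorem one_sub_projOne_posSemidef (i : Fin n) : (1 - projOne i).PosSemidef := by
  rw [projOne, ← diagonal_one, diagonal_sub]
  refine PosSemidef.diagonal fun x => ?_
  show (0 : ℂ) ≤ 1 - if x i = 1 then 1 else 0
  split_ifs <;> simp

theorem isContraction_conj_projOne {U : Matrix (Bits (Fin n)) (Bits (Fin n)) ℂ}
    (hU : U * Uᴴ = 1) (i : Fin n) : IsContraction (U * projOne i * Uᴴ) := by
  have hU' : Uᴴ * U = 1 := mul_eq_one_comm.1 hU
  have e : U * projOne i * Uᴴ * (U * projOne i * Uᴴ)ᴴ = U * projOne i * Uᴴ := by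
    have : U * projOne i * Uᴴ * (U * projOne i * Uᴴ)ᴴ
        = U * (projOne i * (Uᴴ * U) * (projOne i)ᴴ) * Uᴴ := by
      simp [Matrix.mul_assoc]
    rw [this, hU', Matrix.mul_one, projOne_mul_conjTranspose]
  have := (one_sub_projOne_posSemidef i).mul_mul_conjTranspose_same U
  rwa [Matrix.mul_sub, Matrix.sub_mul, Matrix.mul_one, hU, ← e] at this

/-- A union bound on the diagonal of `σ`: each label other than `0…0` has a qubit equal to `1`, so
its weight is counted at least once on the right. -/
theorem one_sub_le_sum_trace_projOne {σ : Matrix (Bits (Fin n)) (Bits (Fin n)) ℂ}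
    (hσ : IsState σ) :
    1 - (σ (fun _ => 0) (fun _ => 0)).re ≤ ∑ i, (projOne i * σ).trace.re := by
  have h1 : ∑ x, (σ x x).re = 1 := by
    have := congrArg Complex.re hσ.2
    simpa [Matrix.trace] using this
  have h0 : ∀ x, 0 ≤ (σ x x).re := fun x => (Complex.le_def.1 hσ.1.diag_nonneg).1
  have h2 : ∑ i, (projOne i * σ).trace.re = ∑ x, ∑ i, if x i = 1 then (σ x x).re else 0 := by
    rw [Finset.sum_comm]
    refine Finset.sum_congr rfl fun i _ => ?_
    simp only [projOne, Matrix.trace, Matrix.diag, diagonal_mul, Complex.re_sum]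
    refine Finset.sum_congr rfl fun x _ => ?_
    split_ifs <;> simp
  rw [h2, ← h1, ← Finset.sum_erase_eq_sub (Finset.mem_univ _)]
  refine (Finset.sum_le_sum fun x hx => ?_).trans
    (Finset.sum_le_sum_of_subset_of_nonneg (Finset.subset_univ _) fun x _ _ =>
      Finset.sum_nonneg fun i _ => by split_ifs <;> simp [h0])
  obtain ⟨i, hi⟩ : ∃ i, x i ≠ 0 := by
    by_contra! h
    exact (Finset.mem_erase.1 hx).1 (funext h)
  have hi1 : x i = 1 := by omega
  refine le_trans (by rw [if_pos hi1]) (Finset.single_le_sum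
    (f := fun i => if x i = 1 then (σ x x).re else 0)
    (fun j _ => by split_ifs <;> simp [h0]) (Finset.mem_univ i))

theorem conj_mulVec_single_apply (U ρ : Matrix (Bits (Fin n)) (Bits (Fin n)) ℂ) :
    star (U *ᵥ ketZero n) ⬝ᵥ (ρ *ᵥ (U *ᵥ ketZero n))
      = (Uᴴ * ρ * U) (fun _ => 0) (fun _ => 0) := by
  rw [star_mulVec, ← Matrix.dotProduct_mulVec, Matrix.mulVec_mulVec, Matrix.mulVec_mulVec,
    ketZero]
  simp

theorem isState_conj {U ρ : Matrix (Bits (Fin n)) (Bits (Fin n)) ℂ} (hU : U * Uᴴ = 1)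
    (hρ : IsState ρ) : IsState (Uᴴ * ρ * U) := by
  refine ⟨hρ.1.conjTranspose_mul_mul_same U, ?_⟩
  rw [Matrix.mul_assoc, Matrix.trace_mul_comm, Matrix.mul_assoc, hU, Matrix.mul_one, hρ.2]

theorem star_dotProduct_self_output (C : Circuit G) : star C.output ⬝ᵥ C.output = 1 := by
  rw [C.output_eq]
  have := conj_mulVec_single_apply (Circuit.toMatrix C) 1
  rw [Matrix.one_mulVec, Matrix.mul_one, mul_eq_one_comm.1 (Circuit.mul_conjTranspose C)] at this
  simpa using this

theorem trace_projOne_mul_pureState_ketZero (i : Fin n) :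
    (projOne i * pureState (ketZero n)).trace = 0 := by
  simp only [projOne, Matrix.trace, Matrix.diag, diagonal_mul, pureState, vecMulVec_apply]
  refine Finset.sum_eq_zero fun x _ => ?_
  rcases eq_or_ne x (fun _ => 0) with rfl | h
  · simp
  · simp [ketZero, Pi.single_eq_of_ne h]

theorem trace_conj_projOne_mul_pureState {U : Matrix (Bits (Fin n)) (Bits (Fin n)) ℂ}
    (hU : U * Uᴴ = 1) (i : Fin n) :
    (U * projOne i * Uᴴ * pureState (U *ᵥ ketZero n)).trace = 0 := by
  have hU' : Uᴴ * U = 1 := mul_eq_one_comm.1 hU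
  have e : pureState (U *ᵥ ketZero n) = U * pureState (ketZero n) * Uᴴ := by
    rw [pureState, pureState, star_mulVec, mul_vecMulVec, vecMulVec_mul]
  have : U * projOne i * Uᴴ * (U * pureState (ketZero n) * Uᴴ)
      = U * (projOne i * (Uᴴ * U) * pureState (ketZero n)) * Uᴴ := by simp only [Matrix.mul_assoc]
  rw [e, this, Matrix.trace_mul_comm, ← Matrix.mul_assoc, hU', Matrix.one_mul, Matrix.mul_one,
    trace_projOne_mul_pureState_ketZero]

/-- A state whose marginals are close to those of a shallow state is close to it. -/
theorem traceNorm_sub_le_of_marginals (g : Geometry n) {D : ℕ} (hD : 1 ≤ g.locality D)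
    {ψ : Bits (Fin n) → ℂ} (hψ : circuitComplexity g.graph ψ ≤ D)
    {ρ : Matrix (Bits (Fin n)) (Bits (Fin n)) ℂ} (hρ : IsState ρ) {δ : ℝ}
    (h : ∀ s : Finset (Fin n), s.card = min (g.locality D) n →
      traceNorm (reduced (pureState ψ) s - reduced ρ s) ≤ δ) :
    traceNorm (pureState ψ - ρ) ≤ 2 * √(n * δ) := by
  obtain ⟨C, rfl, hC⟩ := exists_circuit hψ
  refine (traceNorm_pureState_sub_le (star_dotProduct_self_output C) hρ).trans ?_
  gcongr
  have hU := Circuit.mul_conjTranspose C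
  set U := Circuit.toMatrix C with hUdef
  have hout : C.output = U *ᵥ ketZero n := C.output_eq
  rw [hout] at h ⊢
  rw [conj_mulVec_single_apply]
  refine (one_sub_le_sum_trace_projOne (isState_conj hU hρ)).trans ?_
  have hi : ∀ i : Fin n, (projOne i * (Uᴴ * ρ * U)).trace.re ≤ δ := fun i => by
    -- The hypothesis speaks of sets of exactly `min k n` qubits, so the cone is padded to that
    -- size.
    obtain ⟨s, hs, hcard⟩ := Finset.exists_superset_card_eq (s := cone C {i})
      (n := min (g.locality D) n)
      (le_min (card_cone_le_locality g C i hC hD) (by simpa using (cone C {i}).card_le_univ))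
      (by simp)
    obtain ⟨K, hK⟩ := ((projOne_isLocal i).conj_circuit C).mono hs
    have hKc : IsContraction K := by
      rw [← isContraction_extend s, ← hK]
      exact isContraction_conj_projOne hU i
    -- Since `Pᵢ` annihilates `ψ`, subtracting `ψ` is free, and the expectation in `ρ` becomes one
    -- in the difference of marginals.
    have e : (projOne i * (Uᴴ * ρ * U)).trace
        = -(K * (reduced (pureState (U *ᵥ ketZero n)) s - reduced ρ s)).trace := by
      rw [← reduced_sub, ← trace_extend_mul, ← hK, Matrix.mul_sub, Matrix.trace_sub,
        trace_conj_projOne_mul_pureState hU, zero_sub, neg_neg, ← Matrix.mul_assoc,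
        Matrix.trace_mul_comm]
      simp only [Matrix.mul_assoc]
      rfl
    calc (projOne i * (Uᴴ * ρ * U)).trace.re ≤ ‖(projOne i * (Uᴴ * ρ * U)).trace‖ :=
          Complex.re_le_norm _
      _ ≤ δ := by
        rw [e, norm_neg]
        exact (hKc.norm_trace_mul_le _).trans (h s hcard)
  exact (Finset.sum_le_sum fun i _ => hi i).trans (by simp)

end Parent

/-! ### Independent samples from a finite set -/

section Sampling

variable {R κ : Type} [Fintype R] [Fintype κ]

/-- Nonnegative weights of total mass one. -/
def IsProb (p : R → ℝ) : Prop := (∀ r, 0 ≤ p r) ∧ ∑ r, p r = 1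

variable [DecidableEq κ]

theorem sum_prod_eq (f : κ → R → ℝ) : ∑ d : κ → R, ∏ j, f j (d j) = ∏ j, ∑ r, f j r := by
  rw [Finset.prod_univ_sum, Fintype.piFinset_univ]

theorem IsProb.pi {p : R → ℝ} (hp : IsProb p) : IsProb fun d : κ → R => ∏ j, p (d j) :=
  ⟨fun _ => Finset.prod_nonneg fun _ _ => hp.1 _, by rw [sum_prod_eq fun _ => p]; simp [hp.2]⟩

open Classical in
/-- The probability of an event about independent samples. -/
noncomputable def iidProb (p : R → ℝ) (E : (κ → R) → Prop) : ℝ :=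
  ∑ d : κ → R, if E d then ∏ j, p (d j) else 0

theorem iidProb_mono {p : R → ℝ} (hp : IsProb p) {E F : (κ → R) → Prop} (h : ∀ d, E d → F d) :
    iidProb p E ≤ iidProb p F := by
  classical
  refine Finset.sum_le_sum fun d _ => ?_
  have := hp.pi.1 d
  by_cases hE : E d
  · rw [if_pos hE, if_pos (h d hE)]
  · rw [if_neg hE]; split_ifs <;> simp [this]

theorem iidProb_add_not {p : R → ℝ} (hp : IsProb p) (E : (κ → R) → Prop) :
    iidProb p E + iidProb p (fun d => ¬ E d) = 1 := by
  classical
  rw [iidProb, iidProb, ← Finset.sum_add_distrib, ← (hp.pi (κ := κ)).2]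
  refine Finset.sum_congr rfl fun d _ => ?_
  by_cases hE : E d <;> simp [hE]

theorem iidProb_true {p : R → ℝ} (hp : IsProb p) {E : (κ → R) → Prop} (h : ∀ d, E d) :
    iidProb p E = 1 := by
  rw [← (hp.pi (κ := κ)).2]
  exact Finset.sum_congr rfl fun d _ => if_pos (h d)

theorem iidProb_union_le {σ : Type*} {p : R → ℝ} (hp : IsProb p) (T : Finset σ)
    (E : σ → (κ → R) → Prop) :
    iidProb p (fun d => ∃ s ∈ T, E s d) ≤ ∑ s ∈ T, iidProb p (E s) := by
  classical
  simp only [iidProb]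
  rw [Finset.sum_comm]
  refine Finset.sum_le_sum fun d _ => ?_
  have h0 : ∀ s ∈ T, 0 ≤ if E s d then ∏ j, p (d j) else 0 := fun s _ => by
    split_ifs <;> simp [hp.pi.1 d]
  split_ifs with h
  · obtain ⟨s, hs, hE⟩ := h
    refine le_trans (by rw [if_pos hE]) (Finset.single_le_sum h0 hs)
  · exact Finset.sum_nonneg h0

/-- Chernoff's bound for the number of failures among independent trials. -/
theorem iidProb_half_bad_le {p : R → ℝ} (hp : IsProb p) (bad : R → Prop) [DecidablePred bad]
    (hbad : ∑ r, (if bad r then p r else 0) ≤ 1 / 16) :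
    iidProb p (fun d : κ → R => Fintype.card κ ≤ 2 * (Finset.univ.filter fun j => bad (d j)).card)
      ≤ (1 / 2) ^ Fintype.card κ := by
  classical
  set L := Fintype.card κ
  -- Exponential moment with weight `9`: its mean is at most `1 + 8/16 = 3/2`, while at least half
  -- bad trials force the product to be at least `9^{L/2} = 3^L`. The quotient is `(1/2)^L`.
  set t : R → ℝ := fun r => if bad r then 9 else 1
  have h1 : ∑ r, p r * t r ≤ 3 / 2 := by
    have : ∑ r, p r * t r = ∑ r, p r + 8 * ∑ r, (if bad r then p r else 0) := by
      rw [Finset.mul_sum, ← Finset.sum_add_distrib]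
      refine Finset.sum_congr rfl fun r _ => ?_
      simp only [t]; split_ifs <;> ring
    rw [this, hp.2]; linarith
  have h2 : iidProb p (fun d : κ → R => L ≤ 2 * (Finset.univ.filter fun j => bad (d j)).card)
      * 3 ^ L ≤ (3 / 2) ^ L := by
    have h3 : ∑ d : κ → R, ∏ j, p (d j) * t (d j) ≤ (3 / 2) ^ L := by
      rw [sum_prod_eq fun _ r => p r * t r, Finset.prod_const, Finset.card_univ]
      refine pow_le_pow_left₀ (Finset.sum_nonneg fun r _ => mul_nonneg (hp.1 r) ?_) h1 _
      simp only [t]; split_ifs <;> norm_num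
    refine le_trans ?_ h3
    rw [iidProb, Finset.sum_mul]
    refine Finset.sum_le_sum fun d _ => ?_
    have hw := hp.pi.1 d
    have ht : ∏ j, t (d j) = 9 ^ (Finset.univ.filter fun j => bad (d j)).card := by
      simp only [t]; rw [Finset.prod_ite]; simp
    rw [Finset.prod_mul_distrib, ht]
    split_ifs with h
    · refine mul_le_mul_of_nonneg_left ?_ hw
      calc (3 : ℝ) ^ L ≤ 3 ^ (2 * (Finset.univ.filter fun j => bad (d j)).card) :=
            pow_le_pow_right₀ (by norm_num) h
        _ = _ := by rw [pow_mul]; norm_num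
    · rw [zero_mul]; positivity
  have h4 : (3 / 2 : ℝ) ^ L = (1 / 2) ^ L * 3 ^ L := by rw [← mul_pow]; norm_num
  rw [h4] at h2
  exact le_of_mul_le_mul_right h2 (by positivity)

-- Both moments go through one induction because the vanishing first moment kills the cross term in
-- the second.
omit [Fintype κ] [DecidableEq κ] in
theorem sum_prod_mul_sum_of_mean_zero {p : R → ℝ} (hp : IsProb p) {g : R → ℝ}
    (hg : ∑ r, p r * g r = 0) (m : ℕ) :
    ∑ d : Fin m → R, (∏ j, p (d j)) * ∑ t, g (d t) = 0 ∧
      ∑ d : Fin m → R, (∏ j, p (d j)) * (∑ t, g (d t)) ^ 2 = m * ∑ r, p r * g r ^ 2 := by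
  induction m with
  | zero => simp
  | succ m ih =>
    have hone := (hp.pi (κ := Fin m)).2
    have split : ∀ F : (Fin (m + 1) → R) → ℝ,
        ∑ d, F d = ∑ r : R, ∑ d : Fin m → R, F (Fin.cons r d) := fun F => by
      rw [← (Fin.consEquiv fun _ => R).sum_comp, Fintype.sum_prod_type]; rfl
    rw [split, split]
    simp only [Fin.prod_univ_succ, Fin.sum_univ_succ, Fin.cons_zero, Fin.cons_succ]
    constructor
    · have : ∀ r, ∑ d : Fin m → R, (p r * ∏ j, p (d j)) * (g r + ∑ t, g (d t))
          = p r * g r := fun r => by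
        calc _ = p r * g r * ∑ d : Fin m → R, ∏ j, p (d j)
              + p r * ∑ d : Fin m → R, (∏ j, p (d j)) * ∑ t, g (d t) := by
              rw [Finset.mul_sum, Finset.mul_sum, ← Finset.sum_add_distrib]
              exact Finset.sum_congr rfl fun d _ => by ring
          _ = _ := by rw [hone, ih.1]; ring
      simp only [this, hg]
    · have : ∀ r, ∑ d : Fin m → R, (p r * ∏ j, p (d j)) * (g r + ∑ t, g (d t)) ^ 2
          = p r * g r ^ 2 + p r * (m * ∑ r, p r * g r ^ 2) := fun r => by
        calc _ = p r * g r ^ 2 * ∑ d : Fin m → R, ∏ j, p (d j)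
              + 2 * p r * g r * (∑ d : Fin m → R, (∏ j, p (d j)) * ∑ t, g (d t))
              + p r * ∑ d : Fin m → R, (∏ j, p (d j)) * (∑ t, g (d t)) ^ 2 := by
              rw [Finset.mul_sum, Finset.mul_sum, Finset.mul_sum, ← Finset.sum_add_distrib,
                ← Finset.sum_add_distrib]
              exact Finset.sum_congr rfl fun d _ => by ring
          _ = _ := by rw [hone, ih.1, ih.2]; ring
      simp only [this]
      rw [Finset.sum_add_distrib, ← Finset.sum_mul, hp.2]
      push_cast; ring

omit [Fintype κ] [DecidableEq κ] in
/-- The variance of an empirical mean. -/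
theorem variance_mean_le {p : R → ℝ} (hp : IsProb p) (f : R → ℝ) {m : ℕ} (hm : 0 < m) :
    ∑ d : Fin m → R, (∏ j, p (d j)) * ((m : ℝ)⁻¹ * ∑ t, f (d t) - ∑ r, p r * f r) ^ 2
      ≤ (m : ℝ)⁻¹ * ∑ r, p r * f r ^ 2 := by
  set μ := ∑ r, p r * f r with hμ
  have hm' : (m : ℝ) ≠ 0 := by positivity
  have hg : ∑ r, p r * (f r - μ) = 0 := by
    simp only [mul_sub, Finset.sum_sub_distrib]
    rw [← Finset.sum_mul, hp.2, one_mul, ← hμ, sub_self]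
  have hg2 : ∑ r, p r * (f r - μ) ^ 2 ≤ ∑ r, p r * f r ^ 2 := by
    have : ∑ r, p r * (f r - μ) ^ 2 = ∑ r, p r * f r ^ 2 - μ ^ 2 := by
      have e : ∀ r, p r * (f r - μ) ^ 2 = p r * f r ^ 2 - 2 * μ * (p r * f r) + μ ^ 2 * p r :=
        fun r => by ring
      simp only [e, Finset.sum_add_distrib, Finset.sum_sub_distrib, ← Finset.mul_sum, hp.2, ← hμ]
      ring
    rw [this]; nlinarith
  have key := (sum_prod_mul_sum_of_mean_zero hp hg m).2
  have e : ∀ d : Fin m → R, (∏ j, p (d j)) * ((m : ℝ)⁻¹ * ∑ t, f (d t) - μ) ^ 2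
      = (m : ℝ)⁻¹ ^ 2 * ((∏ j, p (d j)) * (∑ t, (f (d t) - μ)) ^ 2) := fun d => by
    rw [Finset.sum_sub_distrib]
    simp only [Finset.sum_const, Finset.card_univ, Fintype.card_fin, nsmul_eq_mul]
    field_simp
  simp only [e]
  rw [← Finset.mul_sum, key]
  have : (m : ℝ)⁻¹ ^ 2 * (m * ∑ r, p r * (f r - μ) ^ 2)
      = (m : ℝ)⁻¹ * ∑ r, p r * (f r - μ) ^ 2 := by field_simp
  rw [this]
  gcongr

/-- The empirical mean of matrices. -/
noncomputable def empMean {ι : Type} (X : R → Matrix ι ι ℂ) {m : ℕ} (d : Fin m → R) :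
    Matrix ι ι ℂ :=
  fun a b => (m : ℂ)⁻¹ * ∑ t, X (d t) a b

variable {ι : Type} [Fintype ι] [DecidableEq ι]

omit [Fintype κ] [DecidableEq κ] [DecidableEq ι] in
theorem sum_hsSq_empMean_sub_le {p : R → ℝ} (hp : IsProb p) (X : R → Matrix ι ι ℂ)
    {μ : Matrix ι ι ℂ} (hμ : ∀ a b, ∑ r, (p r : ℂ) * X r a b = μ a b) {Q : ℝ}
    (hQ : ∀ r, hsSq (X r) ≤ Q) {m : ℕ} (hm : 0 < m) :
    ∑ d : Fin m → R, (∏ j, p (d j)) * hsSq (empMean X d - μ) ≤ (m : ℝ)⁻¹ * Q := by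
  have sq : ∀ z : ℂ, ‖z‖ ^ 2 = z.re ^ 2 + z.im ^ 2 := fun z => by
    rw [← Complex.normSq_eq_norm_sq, Complex.normSq_apply]; ring
  have hre : ∀ (d : Fin m → R) a b, ((empMean X d - μ) a b).re
      = (m : ℝ)⁻¹ * ∑ t, (X (d t) a b).re - ∑ r, p r * (X r a b).re := fun d a b => by
    rw [Matrix.sub_apply, ← hμ, empMean, ← Complex.ofReal_natCast, ← Complex.ofReal_inv]
    simp only [Complex.sub_re, Complex.re_ofReal_mul, Complex.re_sum]
  have him : ∀ (d : Fin m → R) a b, ((empMean X d - μ) a b).im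
      = (m : ℝ)⁻¹ * ∑ t, (X (d t) a b).im - ∑ r, p r * (X r a b).im := fun d a b => by
    rw [Matrix.sub_apply, ← hμ, empMean, ← Complex.ofReal_natCast, ← Complex.ofReal_inv]
    simp only [Complex.sub_im, Complex.im_ofReal_mul, Complex.im_sum]
  calc ∑ d : Fin m → R, (∏ j, p (d j)) * hsSq (empMean X d - μ)
      = ∑ a : ι, ∑ b : ι, (∑ d : Fin m → R, (∏ j, p (d j)) * ((empMean X d - μ) a b).re ^ 2
          + ∑ d : Fin m → R, (∏ j, p (d j)) * ((empMean X d - μ) a b).im ^ 2) := by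
        simp only [hsSq, sq, Finset.mul_sum, ← Finset.sum_add_distrib, ← mul_add]
        rw [Finset.sum_comm]
        exact Finset.sum_congr rfl fun a _ => Finset.sum_comm
    _ ≤ ∑ a : ι, ∑ b : ι, ((m : ℝ)⁻¹ * ∑ r, p r * (X r a b).re ^ 2
          + (m : ℝ)⁻¹ * ∑ r, p r * (X r a b).im ^ 2) := by
        refine Finset.sum_le_sum fun a _ => Finset.sum_le_sum fun b _ => ?_
        simp only [hre, him]
        exact add_le_add (variance_mean_le hp (fun r => (X r a b).re) hm)
          (variance_mean_le hp (fun r => (X r a b).im) hm)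
    _ = (m : ℝ)⁻¹ * ∑ r, p r * hsSq (X r) := by
        simp only [hsSq, sq, Finset.mul_sum, ← Finset.sum_add_distrib, ← mul_add]
        rw [Finset.sum_comm (s := (Finset.univ : Finset R))]
        exact Finset.sum_congr rfl fun a _ => Finset.sum_comm
    _ ≤ (m : ℝ)⁻¹ * ∑ r, p r * Q := by
        gcongr with r _
        · exact hp.1 r
        · exact hQ r
    _ = _ := by rw [← Finset.sum_mul, hp.2, one_mul]

-- Chebyshev's inequality, with `sq_traceNorm_le` passing to the Hilbert–Schmidt norm. The constant
-- `64` makes the mean at most `η²/64`, which is `1/16` of the squared threshold `(η/2)²`.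
open Classical in
omit [Fintype κ] [DecidableEq κ] in
theorem prob_empMean_bad_le {p : R → ℝ} (hp : IsProb p) (X : R → Matrix ι ι ℂ)
    {μ : Matrix ι ι ℂ} (hμ : ∀ a b, ∑ r, (p r : ℂ) * X r a b = μ a b) {Q : ℝ}
    (hQ : ∀ r, hsSq (X r) ≤ Q) {η : ℝ} (hη : 0 < η) {m : ℕ} (hm : 0 < m)
    (hmQ : 64 * (Fintype.card ι * Q) ≤ m * η ^ 2) :
    ∑ d : Fin m → R, (if ¬ traceNorm (empMean X d - μ) ≤ η / 2 then ∏ j, p (d j) else 0)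
      ≤ 1 / 16 := by
  have h1 : (∑ d : Fin m → R, (if ¬ traceNorm (empMean X d - μ) ≤ η / 2 then ∏ j, p (d j) else 0))
      * (η / 2) ^ 2 ≤ Fintype.card ι * ((m : ℝ)⁻¹ * Q) := by
    refine le_trans ?_ (mul_le_mul_of_nonneg_left (sum_hsSq_empMean_sub_le hp X hμ hQ hm)
      (Nat.cast_nonneg _))
    rw [Finset.sum_mul, Finset.mul_sum]
    refine Finset.sum_le_sum fun d _ => ?_
    have hw := hp.pi.1 d
    split_ifs with h
    · rw [zero_mul]
      exact mul_nonneg (Nat.cast_nonneg _) (mul_nonneg hw (hsSq_nonneg _))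
    · rw [mul_left_comm]
      refine mul_le_mul_of_nonneg_left (le_trans ?_ (sq_traceNorm_le _)) hw
      have := not_le.1 h
      gcongr
  have hm' : (0 : ℝ) < m := by exact_mod_cast hm
  have h2 : (Fintype.card ι : ℝ) * ((m : ℝ)⁻¹ * Q) ≤ η ^ 2 / 64 := by
    rw [mul_left_comm, inv_mul_le_iff₀ hm']
    linarith
  refine le_of_mul_le_mul_right (h1.trans (h2.trans ?_)) (by positivity : 0 < (η / 2) ^ 2)
  linarith

omit [Fintype κ] [DecidableEq κ] in
theorem iidProb_batches {p : R → ℝ} {L m : ℕ} (E : (Fin L → Fin m → R) → Prop) :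
    iidProb p (fun d : Fin (L * m) → R => E fun l t => d (finProdFinEquiv (l, t)))
      = iidProb (fun b : Fin m → R => ∏ t, p (b t)) E := by
  classical
  simp only [iidProb]
  let e : (Fin (L * m) → R) ≃ (Fin L → Fin m → R) :=
    (Equiv.arrowCongr finProdFinEquiv.symm (Equiv.refl R)).trans (Equiv.curry _ _ _)
  rw [← e.sum_comp]
  refine Finset.sum_congr rfl fun d _ => ?_
  have h1 : e d = fun l t => d (finProdFinEquiv (l, t)) := rfl
  rw [h1, ← finProdFinEquiv.prod_comp, Fintype.prod_prod_type]

/-- The matrix `M` is close to the empirical means of more than half of the batches. -/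
def IsCentral (X : R → Matrix ι ι ℂ) (η : ℝ) {L m : ℕ} (D : Fin L → Fin m → R)
    (M : Matrix ι ι ℂ) : Prop :=
  open Classical in
  2 * (Finset.univ.filter fun l => ¬ traceNorm (empMean X (D l) - M) ≤ η / 2).card < L

-- Two strict majorities of batches share a batch, and its mean is within `η/2` of both matrices.
-- This replaces the median, which has no direct meaning for matrices.
omit [Fintype R] [Fintype κ] [DecidableEq κ] in
theorem IsCentral.traceNorm_sub_le {X : R → Matrix ι ι ℂ} {η : ℝ} {L m : ℕ}
    {D : Fin L → Fin m → R} {M M' : Matrix ι ι ℂ} (h : IsCentral X η D M)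
    (h' : IsCentral X η D M') : traceNorm (M - M') ≤ η := by
  classical
  obtain ⟨l, h1, h2⟩ : ∃ l, traceNorm (empMean X (D l) - M) ≤ η / 2 ∧
      traceNorm (empMean X (D l) - M') ≤ η / 2 := by
    by_contra! hne
    unfold IsCentral at h h'
    have hc : Finset.univ ⊆ (Finset.univ.filter fun l => ¬ traceNorm (empMean X (D l) - M) ≤ η / 2)
        ∪ (Finset.univ.filter fun l => ¬ traceNorm (empMean X (D l) - M') ≤ η / 2) := by
      intro l _
      simp only [Finset.mem_union, Finset.mem_filter, Finset.mem_univ, true_and]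
      by_cases hl : traceNorm (empMean X (D l) - M) ≤ η / 2
      · exact Or.inr (not_le.2 (hne l hl))
      · exact Or.inl hl
    have := (Finset.card_le_card hc).trans (Finset.card_union_le _ _)
    rw [Finset.card_univ, Fintype.card_fin] at this
    convert_to 2 * _ < L at h
    omega
  have := ShallowTest.traceNorm_sub_le M (empMean X (D l)) M'
  rw [traceNorm_sub_comm M (empMean X (D l))] at this
  linarith

omit [Fintype κ] [DecidableEq κ] in
theorem iidProb_not_isCentral_le {p : R → ℝ} (hp : IsProb p) (X : R → Matrix ι ι ℂ)
    {μ : Matrix ι ι ℂ} (hμ : ∀ a b, ∑ r, (p r : ℂ) * X r a b = μ a b) {Q : ℝ}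
    (hQ : ∀ r, hsSq (X r) ≤ Q) {η : ℝ} (hη : 0 < η) {m : ℕ} (hm : 0 < m)
    (hmQ : 64 * (Fintype.card ι * Q) ≤ m * η ^ 2) (L : ℕ) :
    iidProb p (fun d : Fin (L * m) → R =>
      ¬ IsCentral X η (fun l t => d (finProdFinEquiv (l, t))) μ) ≤ (1 / 2) ^ L := by
  classical
  rw [iidProb_batches (E := fun D : Fin L → Fin m → R => ¬ IsCentral X η D μ)]
  have := iidProb_half_bad_le (κ := Fin L) hp.pi
    (fun b : Fin m → R => ¬ traceNorm (empMean X b - μ) ≤ η / 2) (by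
      convert prob_empMean_bad_le hp X hμ hQ hη hm hmQ)
  rw [Fintype.card_fin] at this
  refine le_trans (le_of_eq ?_) this
  congr 1
  ext D
  rw [IsCentral, not_lt]

end Sampling

/-! ### Classical shadows from random Pauli measurements -/

section Shadows

/-- The effect of one qubit for a Pauli basis and an outcome. -/
noncomputable def qubitEffect (q : Fin 3 × Fin 2) : Matrix (Fin 2) (Fin 2) ℂ :=
  (1 / 6 : ℂ) • (1 + (-1 : ℂ) ^ (q.2 : ℕ) • pauli q.1)

/-- The shadow of one qubit for a Pauli basis and an outcome. -/
noncomputable def qubitShadow (q : Fin 3 × Fin 2) : Matrix (Fin 2) (Fin 2) ℂ :=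
  (1 / 2 : ℂ) • (1 + (3 * (-1 : ℂ) ^ (q.2 : ℕ)) • pauli q.1)

theorem sum_qubitEffect (x y : Fin 2) :
    ∑ q, qubitEffect q y x = if x = y then 1 else 0 := by
  fin_cases x <;> fin_cases y <;>
    simp [qubitEffect, pauli, Fintype.sum_prod_type, Fin.sum_univ_three] <;> norm_num

/-- The shadows form a dual frame to the effects: weighting them by outcome probabilities recovers
the qubit state. The factor `3` in `qubitShadow` undoes the chance `1/3` of choosing a given basis.
-/
theorem sum_qubitEffect_mul_qubitShadow (x y a b : Fin 2) :
    ∑ q, qubitEffect q y x * qubitShadow q a b = if x = a ∧ y = b then 1 else 0 := by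
  fin_cases x <;> fin_cases y <;> fin_cases a <;> fin_cases b <;>
    simp [qubitEffect, qubitShadow, pauli, Fintype.sum_prod_type, Fin.sum_univ_three] <;>
    ring_nf <;> simp <;> norm_num

theorem sum_norm_sq_qubitShadow (q : Fin 3 × Fin 2) :
    ∑ a, ∑ b, ‖qubitShadow q a b‖ ^ 2 = 5 := by
  obtain ⟨P, b⟩ := q
  fin_cases P <;> fin_cases b <;>
    simp [qubitShadow, pauli] <;> norm_num

theorem qubitEffect_mul_conjTranspose (q : Fin 3 × Fin 2) :
    qubitEffect q * (qubitEffect q)ᴴ = (1 / 3 : ℂ) • qubitEffect q := by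
  obtain ⟨P, b⟩ := q
  ext i j
  fin_cases P <;> fin_cases b <;> fin_cases i <;> fin_cases j <;>
    simp [qubitEffect, pauli, Matrix.mul_apply] <;> ring_nf <;>
    norm_num [Complex.conj_ofNat] <;> ring

variable {n : ℕ}

theorem recordEffect_apply (r : Record n) (x y : Bits (Fin n)) :
    recordEffect r x y = ∏ i, qubitEffect (r i) (x i) (y i) := rfl

/-- Each one-qubit effect is `1/3` of a projection. Writing the tensor product as a multiple of `E
Eᴴ` makes its positivity, hence that of the outcome probabilities, evident. -/
theorem recordEffect_eq (r : Record n) :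
    recordEffect r = (3 : ℂ) ^ n • (recordEffect r * (recordEffect r)ᴴ) := by
  ext x y
  have h : (recordEffect r * (recordEffect r)ᴴ) x y = (1 / 3 : ℂ) ^ n * recordEffect r x y := by
    have e : ∀ i, ∑ u, qubitEffect (r i) (x i) u * star (qubitEffect (r i) (y i) u)
        = (1 / 3 : ℂ) * qubitEffect (r i) (x i) (y i) := fun i => by
      have := congrFun (congrFun (qubitEffect_mul_conjTranspose (r i)) (x i)) (y i)
      simpa [Matrix.mul_apply] using this
    simp only [Matrix.mul_apply, conjTranspose_apply, recordEffect_apply, star_prod,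
      ← Finset.prod_mul_distrib]
    rw [← Fintype.piFinset_univ, ← Finset.prod_univ_sum (fun _ => Finset.univ)
      (fun i u => qubitEffect (r i) (x i) u * star (qubitEffect (r i) (y i) u))]
    simp only [e, Finset.prod_mul_distrib, Finset.prod_const, Finset.card_univ, Fintype.card_fin]
  rw [Matrix.smul_apply, h, smul_eq_mul, ← mul_assoc, ← mul_pow]
  norm_num

theorem trace_mul_recordEffect_nonneg {ρ : Matrix (Bits (Fin n)) (Bits (Fin n)) ℂ}
    (hρ : ρ.PosSemidef) (r : Record n) : 0 ≤ (ρ * recordEffect r).trace := by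
  rw [recordEffect_eq, Matrix.mul_smul, Matrix.trace_smul, ← Matrix.mul_assoc,
    Matrix.trace_mul_comm, ← Matrix.mul_assoc, smul_eq_mul]
  refine mul_nonneg ?_ (hρ.conjTranspose_mul_mul_same _).trace_nonneg
  exact pow_nonneg (by norm_num) _

theorem recordProb_nonneg {ρ : Matrix (Bits (Fin n)) (Bits (Fin n)) ℂ}
    (hρ : ρ.PosSemidef) (r : Record n) : 0 ≤ recordProb ρ r :=
  (Complex.le_def.1 (trace_mul_recordEffect_nonneg hρ r)).1

theorem ofReal_recordProb {ρ : Matrix (Bits (Fin n)) (Bits (Fin n)) ℂ}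
    (hρ : ρ.PosSemidef) (r : Record n) : (recordProb ρ r : ℂ) = (ρ * recordEffect r).trace :=
  Complex.ext rfl (Complex.le_def.1 (trace_mul_recordEffect_nonneg hρ r)).2

/-- The classical shadow of a record on the qubits in `s`. -/
noncomputable def shadow (s : Finset (Fin n)) (r : Record n) :
    Matrix (Bits {i // i ∈ s}) (Bits {i // i ∈ s}) ℂ :=
  fun a b => ∏ i : {i // i ∈ s}, qubitShadow (r i) (a i) (b i)

theorem hsSq_shadow (s : Finset (Fin n)) (r : Record n) : hsSq (shadow s r) = 5 ^ s.card := by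
  simp only [hsSq, shadow, norm_prod, ← Finset.prod_pow]
  have h : ∀ a : Bits {i // i ∈ s},
      ∑ b : Bits {i // i ∈ s}, ∏ i : {i // i ∈ s}, ‖qubitShadow (r i) (a i) (b i)‖ ^ 2
        = ∏ i : {i // i ∈ s}, ∑ v, ‖qubitShadow (r i) (a i) v‖ ^ 2 := fun a =>
    sum_prod_eq fun (i : {i // i ∈ s}) v => ‖qubitShadow (r i) (a i) v‖ ^ 2
  simp only [h]
  rw [sum_prod_eq fun (i : {i // i ∈ s}) u => ∑ v, ‖qubitShadow (r i) u v‖ ^ 2]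
  simp only [sum_norm_sq_qubitShadow]
  simp

/-- The sum factors over the qubits: inside `s` the dual frame identity applies, outside `s` the
completeness of the effects, which performs the partial trace. -/
theorem sum_recordEffect_mul_shadow (s : Finset (Fin n)) (a b a' b' : Bits {i // i ∈ s})
    (z w : Bits {i // i ∉ s}) :
    ∑ r, recordEffect r (glue s b' w) (glue s a' z) * shadow s r a b
      = if a' = a ∧ b' = b ∧ z = w then 1 else 0 := by
  have h1 : ∀ r : Record n, recordEffect r (glue s b' w) (glue s a' z) * shadow s r a b
      = ∏ i, qubitEffect (r i) (glue s b' w i) (glue s a' z i)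
        * (if h : i ∈ s then qubitShadow (r i) (a ⟨i, h⟩) (b ⟨i, h⟩) else 1) := fun r => by
    rw [Finset.prod_mul_distrib, recordEffect_apply, shadow]
    congr 1
    rw [← Fintype.prod_subtype_mul_prod_subtype (fun i => i ∈ s)]
    have e1 : ∀ i : {i // i ∈ s}, (if h : (i : Fin n) ∈ s then
        qubitShadow (r i) (a ⟨i, h⟩) (b ⟨i, h⟩) else 1) = qubitShadow (r i) (a i) (b i) :=
      fun i => by rw [dif_pos i.2]
    have e2 : ∀ i : {i // i ∉ s}, (if h : (i : Fin n) ∈ s then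
        qubitShadow (r i) (a ⟨i, h⟩) (b ⟨i, h⟩) else 1) = 1 := fun i => dif_neg i.2
    simp only [e1, e2, Finset.prod_const_one, mul_one]
    exact Finset.prod_congr (by ext; simp) fun _ _ => rfl
  have h2 : ∀ i, ∑ q, qubitEffect q (glue s b' w i) (glue s a' z i)
        * (if h : i ∈ s then qubitShadow q (a ⟨i, h⟩) (b ⟨i, h⟩) else 1)
      = if (∀ h : i ∈ s, a' ⟨i, h⟩ = a ⟨i, h⟩ ∧ b' ⟨i, h⟩ = b ⟨i, h⟩) ∧
          (∀ h : i ∉ s, z ⟨i, h⟩ = w ⟨i, h⟩) then 1 else 0 := fun i => by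
    by_cases h : i ∈ s
    · simp only [dif_pos h, sum_qubitEffect_mul_qubitShadow, glue_of_mem s _ _ h]
      exact if_congr ⟨fun hh => ⟨fun _ => hh, fun h' => absurd h h'⟩, fun hh => hh.1 h⟩ rfl rfl
    · simp only [dif_neg h, mul_one, sum_qubitEffect, glue_of_notMem s _ _ h]
      exact if_congr ⟨fun hh => ⟨fun h' => absurd h' h, fun _ => hh⟩, fun hh => hh.2 h⟩ rfl rfl
  simp only [h1]
  rw [← Fintype.piFinset_univ, ← Finset.prod_univ_sum (fun _ => Finset.univ)
    (fun i q => qubitEffect q (glue s b' w i) (glue s a' z i)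
        * (if h : i ∈ s then qubitShadow q (a ⟨i, h⟩) (b ⟨i, h⟩) else 1))]
  simp only [h2]
  rw [Finset.prod_ite_zero, Finset.prod_const_one]
  by_cases h : a' = a ∧ b' = b ∧ z = w
  · rw [if_pos h, if_pos]
    obtain ⟨rfl, rfl, rfl⟩ := h
    exact fun i _ => ⟨fun _ => ⟨rfl, rfl⟩, fun _ => rfl⟩
  · rw [if_neg h, if_neg]
    refine fun h' => h ⟨funext fun i => ?_, funext fun i => ?_, funext fun i => ?_⟩
    · exact ((h' i (Finset.mem_univ _)).1 i.2).1
    · exact ((h' i (Finset.mem_univ _)).1 i.2).2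
    · exact (h' i (Finset.mem_univ _)).2 i.2

/-- The classical shadow is an unbiased estimator of the reduced density matrix. -/
theorem sum_recordProb_mul_shadow {ρ : Matrix (Bits (Fin n)) (Bits (Fin n)) ℂ}
    (hρ : ρ.PosSemidef) (s : Finset (Fin n)) (a b : Bits {i // i ∈ s}) :
    ∑ r, (recordProb ρ r : ℂ) * shadow s r a b = reduced ρ s a b := by
  have h : ∀ r : Record n, (recordProb ρ r : ℂ) * shadow s r a b
      = ∑ x, ∑ y, ρ x y * (recordEffect r y x * shadow s r a b) := fun r => by
    rw [ofReal_recordProb hρ]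
    simp only [Matrix.trace, Matrix.diag, Matrix.mul_apply, Finset.sum_mul, mul_assoc]
  simp only [h]
  rw [Finset.sum_comm]
  simp only [Finset.sum_comm (s := (Finset.univ : Finset (Record n))), ← Finset.mul_sum]
  simp only [sum_glue s, sum_recordEffect_mul_shadow, ite_and, mul_ite, mul_one, mul_zero,
    Finset.sum_ite_irrel, Finset.sum_const_zero, Finset.sum_ite_eq', Finset.sum_ite_eq,
    Finset.mem_univ, if_true, reduced]

theorem isProb_recordProb {ρ : Matrix (Bits (Fin n)) (Bits (Fin n)) ℂ} (hρ : IsState ρ) :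
    IsProb (recordProb ρ) := by
  refine ⟨recordProb_nonneg hρ.1, ?_⟩
  -- On the empty set the shadow is the scalar `1`, so unbiasedness there says that the total mass
  -- is the trace of `ρ`.
  have h := (isState_reduced ∅ hρ).2
  simp only [Matrix.trace, Matrix.diag, ← sum_recordProb_mul_shadow hρ.1, shadow] at h
  simp at h
  exact_mod_cast h

end Shadows

/-! ### The test -/

section Test

variable {n : ℕ}

open Classical in
/-- The median-of-means estimate of all marginals: for each `s` a matrix that is close to the
empirical means of more than half of the batches. -/
noncomputable def medianEstimate (L m : ℕ) (η : ℝ) (d : Fin (L * m) → Record n) : Marginals n :=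
  fun s => if h : ∃ M, IsCentral (shadow s) η (fun l t => d (finProdFinEquiv (l, t))) M
    then h.choose else 0

/-- The estimate must not refer to `ρ`. It selects any central matrix; when the true marginal is
central too, the two differ by at most `η`. The union bound over all `k`-sets leaves failure
probability at most `1/3`. -/
theorem two_thirds_le_medianEstimate {L m k : ℕ} {η : ℝ} (hη : 0 < η) (hm : 0 < m)
    (hmk : 64 * (10 : ℝ) ^ k ≤ m * η ^ 2) (hL : 3 * n.choose k ≤ 2 ^ L)
    {ρ : Matrix (Bits (Fin n)) (Bits (Fin n)) ℂ} (hρ : IsState ρ) :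
    2 / 3 ≤ dataProb ρ (fun d : Fin (L * m) → Record n =>
      MarginalsWithin k η (medianEstimate L m η d) ρ) := by
  have hp := isProb_recordProb hρ
  change 2 / 3 ≤ iidProb (recordProb ρ) _
  have hbad : iidProb (recordProb ρ) (fun d : Fin (L * m) → Record n =>
      ¬ MarginalsWithin k η (medianEstimate L m η d) ρ) ≤ 1 / 3 := by
    calc _ ≤ iidProb (recordProb ρ) (fun d : Fin (L * m) → Record n =>
          ∃ s ∈ Finset.powersetCard k Finset.univ,
            ¬ IsCentral (shadow s) η (fun l t => d (finProdFinEquiv (l, t))) (reduced ρ s)) := by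
          refine iidProb_mono hp fun d hd => ?_
          by_contra! hc
          refine hd fun s hs => ?_
          have h1 := hc s (Finset.mem_powersetCard.2 ⟨Finset.subset_univ _, hs⟩)
          have h2 : ∃ M, IsCentral (shadow s) η (fun l t => d (finProdFinEquiv (l, t))) M :=
            ⟨_, h1⟩
          rw [medianEstimate, dif_pos h2]
          exact h2.choose_spec.traceNorm_sub_le h1
      _ ≤ ∑ s ∈ Finset.powersetCard k (Finset.univ : Finset (Fin n)), (1 / 2 : ℝ) ^ L := by
          refine (iidProb_union_le hp _ _).trans (Finset.sum_le_sum fun s hs => ?_)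
          have hs' := (Finset.mem_powersetCard.1 hs).2
          refine iidProb_not_isCentral_le hp (shadow s) (sum_recordProb_mul_shadow hρ.1 s)
            (Q := 5 ^ k) (fun r => by rw [hsSq_shadow, hs']) hη hm ?_ L
          have : (Fintype.card (Bits {i // i ∈ s}) : ℝ) = 2 ^ k := by
            simp [Fintype.card_pi, hs']
          rw [this, ← mul_pow]
          norm_num at hmk ⊢
          exact hmk
      _ = n.choose k * (1 / 2) ^ L := by simp
      _ ≤ 1 / 3 := by
          have : (3 * n.choose k : ℝ) ≤ 2 ^ L := by exact_mod_cast hL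
          rw [_root_.one_div_pow, mul_one_div, div_le_div_iff₀ (by positivity) (by norm_num)]
          linarith
  have := iidProb_add_not hp (fun d : Fin (L * m) → Record n =>
      MarginalsWithin k η (medianEstimate L m η d) ρ)
  linarith

/-- The guarantees of the test follow from the accuracy of the estimated marginals. -/
theorem test_correct (hn : 1 ≤ n) (g : Geometry n) {D : ℕ} (hD : 1 ≤ g.locality D) {ε : ℝ}
    (hε : 0 < ε) {N : ℕ} (est : (Fin N → Record n) → Marginals n)
    {ρ : Matrix (Bits (Fin n)) (Bits (Fin n)) ℂ} (hρ : IsState ρ)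
    (h : 2 / 3 ≤ dataProb ρ (fun d : Fin N → Record n =>
      MarginalsWithin (min (g.locality D) n) (ε ^ 2 / (12 * n)) (est d) ρ)) :
    ((∃ ψ : Bits (Fin n) → ℂ, circuitComplexity g.graph ψ ≤ D ∧
        traceNorm (pureState ψ - ρ) < ε ^ 2 / (12 * n)) →
      2 / 3 ≤ dataProb ρ (fun d : Fin N → Record n =>
        SearchAccepts g.graph D (min (g.locality D) n) (ε ^ 2 / (6 * n)) (est d))) ∧
    ((∀ ψ : Bits (Fin n) → ℂ, circuitComplexity g.graph ψ ≤ D →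
        ε < traceNorm (pureState ψ - ρ)) →
      2 / 3 ≤ dataProb ρ (fun d : Fin N → Record n =>
        ¬ SearchAccepts g.graph D (min (g.locality D) n) (ε ^ 2 / (6 * n)) (est d))) := by
  have hp := isProb_recordProb hρ
  have hn' : (0 : ℝ) < n := by exact_mod_cast hn
  have e6 : ε ^ 2 / (6 * n) = ε ^ 2 / (12 * n) + ε ^ 2 / (12 * n) := by field_simp; norm_num
  refine ⟨fun ⟨ψ, hψ, hclose⟩ => h.trans (iidProb_mono hp fun d hd => ⟨ψ, hψ, fun s hs => ?_⟩),
    fun hfar => h.trans (iidProb_mono hp fun d hd => ?_)⟩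
  · have h1 := traceNorm_sub_le (reduced (pureState ψ) s) (reduced ρ s) (est d s)
    have h2 := traceNorm_reduced_le s (pureState ψ - ρ)
    have h3 := hd s hs
    rw [reduced_sub] at h2
    rw [traceNorm_sub_comm] at h3
    rw [e6]
    linarith
  · rintro ⟨ψ, hψ, hacc⟩
    refine (hfar ψ hψ).not_ge ?_
    have := traceNorm_sub_le_of_marginals g hD hψ hρ (δ := ε ^ 2 / (4 * n)) fun s hs => by
      have h1 := traceNorm_sub_le (reduced (pureState ψ) s) (est d s) (reduced ρ s)
      have h2 := hacc s hs
      have h3 := hd s hs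
      have e4 : ε ^ 2 / (4 * n) = ε ^ 2 / (6 * n) + ε ^ 2 / (12 * n) := by field_simp; norm_num
      rw [e4]
      linarith
    have e : (n : ℝ) * (ε ^ 2 / (4 * n)) = (ε / 2) ^ 2 := by field_simp; norm_num
    rw [e, Real.sqrt_sq (by positivity)] at this
    linarith

/-- For `B ≥ 2` one has `3B ≤ B³`, so `3 log₂ B` batches suffice, and rounding up costs at most one
further `log₂ B`. -/
theorem exists_batch_count {B : ℕ} (hB : 2 ≤ B) :
    ∃ L : ℕ, 3 * B ≤ 2 ^ L ∧ (L : ℝ) ≤ 4 / Real.log 2 * Real.log B := by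
  have hl2 : 0 < Real.log 2 := Real.log_pos (by norm_num)
  have hlB : Real.log 2 ≤ Real.log B := Real.log_le_log (by norm_num) (by exact_mod_cast hB)
  have hB' : (2 : ℝ) ≤ B := by exact_mod_cast hB
  refine ⟨⌈3 * Real.log B / Real.log 2⌉₊, ?_, ?_⟩
  · have h1 := Nat.le_ceil (3 * Real.log B / Real.log 2)
    rw [div_le_iff₀ hl2] at h1
    have h2 : Real.log ((B : ℝ) ^ 3) ≤ Real.log (2 ^ ⌈3 * Real.log B / Real.log 2⌉₊) := by
      rw [Real.log_pow, Real.log_pow]; exact_mod_cast h1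
    have h3 := (Real.log_le_log_iff (by positivity) (by positivity)).1 h2
    have h4 : (3 * B : ℝ) ≤ B ^ 3 := by
      have : (3 : ℝ) ≤ B ^ 2 := by nlinarith
      rw [pow_succ]
      gcongr
    exact_mod_cast h4.trans h3
  · have h1 := (Nat.ceil_lt_add_one (a := 3 * Real.log B / Real.log 2)
      (div_nonneg (by linarith) hl2.le)).le
    have h2 : 1 ≤ Real.log B / Real.log 2 := (one_le_div hl2).2 hlB
    calc _ ≤ _ := h1
      _ ≤ 3 * Real.log B / Real.log 2 + Real.log B / Real.log 2 := by linarith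
      _ = _ := by ring

theorem exists_batch_size {η : ℝ} (hη : 0 < η) (hη1 : η < 1) (k : ℕ) :
    ∃ m : ℕ, 0 < m ∧ 64 * (10 : ℝ) ^ k ≤ m * η ^ 2 ∧ (m : ℝ) ≤ 65 * 10 ^ k / η ^ 2 := by
  have h10 : (1 : ℝ) ≤ 10 ^ k := one_le_pow₀ (by norm_num)
  have hη2 : 0 < η ^ 2 := by positivity
  have h1 := Nat.le_ceil (64 * (10 : ℝ) ^ k / η ^ 2)
  refine ⟨⌈64 * (10 : ℝ) ^ k / η ^ 2⌉₊, Nat.ceil_pos.2 (by positivity), ?_, ?_⟩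
  · rwa [div_le_iff₀ hη2] at h1
  · have h2 := (Nat.ceil_lt_add_one (a := 64 * (10 : ℝ) ^ k / η ^ 2) (by positivity)).le
    have h3 : 1 ≤ (10 : ℝ) ^ k / η ^ 2 := by
      rw [one_le_div hη2]; nlinarith
    calc _ ≤ _ := h2
      _ ≤ 64 * (10 : ℝ) ^ k / η ^ 2 + 10 ^ k / η ^ 2 := by linarith
      _ = _ := by ring

theorem marginalsWithin_zero {k : ℕ} {η : ℝ} (hη : 1 ≤ η)
    {ρ : Matrix (Bits (Fin n)) (Bits (Fin n)) ℂ} (hρ : IsState ρ) :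
    MarginalsWithin k η (fun _ => 0) ρ := fun s _ => by
  rw [zero_sub, traceNorm_neg]
  exact (traceNorm_state_le_one (isState_reduced s hρ)).trans hη

end Test
end ShallowTest

/-! ### Choice of the sample size -/

open ShallowTest
theorem mainTheorem5 :
    ∃ c : ℝ, 0 < c ∧
      ∀ (n : ℕ) (_ : 1 ≤ n) (g : Geometry n) (D : ℕ) (_ : 1 ≤ g.locality D) (ε : ℝ) (_ : 0 < ε),
        ∃ N : ℕ,
          (g.locality D < n →
            (N : ℝ) ≤ c * ((n : ℝ) ^ 2 * 10 ^ g.locality D *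
              Real.log (n.choose (g.locality D)) / ε ^ 4)) ∧
          (n ≤ g.locality D → (N : ℝ) ≤ c * ((n : ℝ) ^ 2 * 10 ^ n / ε ^ 4)) ∧
          ∃ est : (Fin N → Record n) → Marginals n,
            ∀ ρ : Matrix (Bits (Fin n)) (Bits (Fin n)) ℂ, IsState ρ →
              2 / 3 ≤ dataProb ρ (fun d : Fin N → Record n =>
                MarginalsWithin (min (g.locality D) n) (ε ^ 2 / (12 * n)) (est d) ρ) ∧
              ((∃ ψ : Bits (Fin n) → ℂ, circuitComplexity g.graph ψ ≤ D ∧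
                  traceNorm (pureState ψ - ρ) < ε ^ 2 / (12 * n)) →
                2 / 3 ≤ dataProb ρ (fun d : Fin N → Record n =>
                  SearchAccepts g.graph D (min (g.locality D) n) (ε ^ 2 / (6 * n)) (est d))) ∧
              ((∀ ψ : Bits (Fin n) → ℂ, circuitComplexity g.graph ψ ≤ D →
                  ε < traceNorm (pureState ψ - ρ)) →
                2 / 3 ≤ dataProb ρ (fun d : Fin N → Record n =>
                  ¬ SearchAccepts g.graph D (min (g.locality D) n) (ε ^ 2 / (6 * n)) (est d))) := by
  have hl2 : 0 < Real.log 2 := Real.log_pos (by norm_num)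
  have hl2' : Real.log 2 < 1 := by have := Real.log_two_lt_d9; linarith
  -- `9360 = 65 · 144`: the batch size is at most `65 · 10^k/η²`, and `1/η² = 144 n²/ε⁴`. The other
  -- factor bounds the number of batches.
  refine ⟨9360 * (4 / Real.log 2), by positivity, fun n hn g D hD ε hε => ?_⟩
  have hn' : (0 : ℝ) < n := by exact_mod_cast hn
  set k := min (g.locality D) n with hk
  set η := ε ^ 2 / (12 * n) with hη
  have hη0 : 0 < η := by positivity
  -- For `η ≥ 1` the zero matrix is an accurate estimate of every marginal and no sample is taken;
  -- for `η < 1` rounding up the batch size is harmless.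
  rcases le_or_gt 1 η with hη1 | hη1
  · refine ⟨0, fun _ => ?_, fun _ => ?_, fun _ _ => 0, fun ρ hρ => ?_⟩
    · have := Real.log_natCast_nonneg (n.choose (g.locality D))
      rw [Nat.cast_zero]; positivity
    · rw [Nat.cast_zero]; positivity
    · have h : 2 / 3 ≤ dataProb ρ (fun _ : Fin 0 → Record n =>
          MarginalsWithin k η (fun _ => 0) ρ) := by
        have := iidProb_true (κ := Fin 0) (isProb_recordProb hρ)
          (E := fun _ => MarginalsWithin k η (fun _ => 0) ρ) fun _ => marginalsWithin_zero hη1 hρ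
        change 2 / 3 ≤ iidProb (recordProb ρ) _
        rw [this]; norm_num
      exact ⟨h, test_correct hn g hD hε (fun _ _ => 0) hρ h⟩
  obtain ⟨m, hm0, hm, hm'⟩ := exists_batch_size hη0 hη1 k
  have hm'' : (m : ℝ) ≤ 9360 * (n ^ 2 * 10 ^ k / ε ^ 4) := by
    refine hm'.trans (le_of_eq ?_)
    rw [hη]; field_simp; norm_num
  obtain ⟨L, hL, hL1, hL2⟩ : ∃ L : ℕ, 3 * n.choose k ≤ 2 ^ L ∧
      (g.locality D < n →
        (L : ℝ) ≤ 4 / Real.log 2 * Real.log (n.choose (g.locality D))) ∧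
      (n ≤ g.locality D → (L : ℝ) ≤ 4 / Real.log 2) := by
    rcases lt_or_ge (g.locality D) n with hlt | hge
    · have hB : 2 ≤ n.choose (g.locality D) := by
        obtain ⟨j, hj⟩ := Nat.exists_eq_add_of_le' hD
        obtain ⟨p, hp⟩ := Nat.exists_eq_add_of_le' hn
        rw [hj, hp, Nat.choose_succ_succ']
        have h1 := Nat.choose_pos (show j ≤ p by omega)
        have h2 := Nat.choose_pos (show j + 1 ≤ p by omega)
        omega
      obtain ⟨L, h1, h2⟩ := exists_batch_count hB
      exact ⟨L, by rwa [hk, min_eq_left hlt.le], fun _ => h2, fun h => absurd h hlt.not_ge⟩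
    · refine ⟨2, by rw [hk, min_eq_right hge]; simp, fun h => absurd h hge.not_gt, fun _ => ?_⟩
      rw [le_div_iff₀ hl2]; push_cast; linarith
  refine ⟨L * m, fun hlt => ?_, fun hge => ?_, medianEstimate L m η, fun ρ hρ => ?_⟩
  · rw [hk, min_eq_left hlt.le] at hm''
    rw [Nat.cast_mul]
    refine (mul_le_mul (hL1 hlt) hm'' (Nat.cast_nonneg _)
      ((Nat.cast_nonneg _).trans (hL1 hlt))).trans (le_of_eq ?_)
    ring
  · rw [hk, min_eq_right hge] at hm''
    rw [Nat.cast_mul]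
    refine (mul_le_mul (hL2 hge) hm'' (Nat.cast_nonneg _) (by positivity)).trans (le_of_eq ?_)
    ring
  · have h := two_thirds_le_medianEstimate hη0 hm0 hm hL hρ
    exact ⟨h, test_correct hn g hD hε _ hρ h⟩
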